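/- \textbf{Lemma 2 (coverage probability of the $k$-th user).} Let $k\ge 1$ be an integer and let $t>0$, $\lambda>0$, $0<p\le 1$, $\alpha>2$, $\epsilon\ge 0$, $\mu>0$, $\sigma\in\mathbb R$. Let the active users form a homogeneous Poisson point process $\Phi$ of intensity $\lambda$ on $\mathbb R^2$. The $k$ points of $\Phi$ nearest to the origin (the position of the target base station) are the $k$ users served by it; let $R_k$ be the distance from the origin to the $k$-th nearest point. The points of $\Phi$ outside the closed ball $B(o,R_k)$ are thinned independently, each being retained with probability $p$ (in the application $p=1/k$); the retained points form the set $\Phi_i$ of interferers. Every user $x$ has a fading coefficient $G_x$, exponentially distributed with mean $1/\mu$; every interferer $x\in\Phi_i$ has distance $D_x=\lVert x\rVert$ to the origin and distance $R_x$ to its own base station, where $R_x$ has the Rayleigh density $2\pi p\lambda r\,e^{-p\lambda\pi r^2}$, $r\ge 0$. All fading coefficients, distances $R_x$ and thinning decisions are mutually independent and independent of $\Phi$. Let $G_k$ be the fading coefficient of the $k$-th nearest user, and put \[ I_k=\sum_{x\in\Phi_i}G_xR_x^{\alpha\epsilon}D_x^{-\alpha},\qquad \mathrm{SINR}_k=\frac{G_kR_k^{\alpha(\epsilon-1)}}{I_k+\sigma^2}.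 \] Then the sum $I_k$ is almost surely finite and positive, $R_k$ has the density \[ f_{R_k}(r_k)=2\,\frac{(\lambda\pi)^k}{(k-1)!}\,r_k^{2k-1}e^{-\lambda\pi r_k^2},\qquad r_k>0, \] and the coverage probability of the $k$-th user is \[ \mathbb P[\mathrm{SINR}_k>t]=\int_0^\infty \xi(r_k)\,f_{R_k}(r_k)\,\mathrm dr_k,\qquad \xi(r_k)=e^{-\mu t\sigma^2r_k^{\alpha(1-\epsilon)}}\,\mathcal L_{I_k|r_k}\bigl(\mu t r_k^{\alpha(1-\epsilon)}\bigr), \] where $\mathcal L_{I_k|r_k}(s)=\mathbb E[e^{-sI_k}\mid R_k=r_k]$ is the Laplace transform of the interference conditioned on $R_k=r_k$, and, for almost every $r_k>0$, \[ \mathcal L_{I_k|r_k}\bigl(\mu t r_k^{\alpha(1-\epsilon)}\bigr) =\exp\left(-2\pi p\lambda\int_{r_k}^\infty\left(1-\int_0^\infty \frac{\pi p\lambda\,e^{-p\lambda\pi q}}{1+t\,r_k^{\alpha(1-\epsilon)}q^{\alpha\epsilon/2}v^{-\alpha}}\,\mathrm dq\right)v\,\mathrm dv\right). \] All the integrals above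 converge. -/

import Mathlib

open MeasureTheory ProbabilityTheory Set

noncomputable section

namespace Uplink

/-- The plane `ℝ²` with its Euclidean norm; the target base station is at the origin. -/
abbrev Plane : Type := EuclideanSpace ℝ (Fin 2)

/-- The counting measure `∑ₙ δ_{xₙ}` of the points `x₀, x₁, …`. -/
def pointMeasure (x : ℕ → Plane) : Measure Plane :=
  Measure.sum fun n => Measure.dirac (x n)

/-- The random measure `N` is a Poisson point process with intensity measure `Λ`: the number of
points in a set of finite intensity is Poisson distributed with mean `Λ A`, and the numbers of
points in pairwise disjoint sets are independent. -/
structure IsPoissonProcess {Ω : Type*} [MeasurableSpace Ω] (N : Ω → Measure Plane)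
    (Λ : Measure Plane) (P : Measure Ω) : Prop where
  measurable : Measurable N
  hasLaw_count : ∀ A : Set Plane, MeasurableSet A → Λ A ≠ ⊤ →
    HasLaw (fun ω => N ω A)
      ((poissonMeasure (Λ A).toNNReal).map (Nat.cast : ℕ → ENNReal)) P
  indep_count : ∀ (m : ℕ) (A : Fin m → Set Plane), (∀ i, MeasurableSet (A i)) →
    Pairwise (fun i j => Disjoint (A i) (A j)) → iIndepFun (fun i ω => N ω (A i)) P

/-- The Rayleigh law with density `2 π b r e^{-b π r²}` on `r ≥ 0`. -/
def rayleighMeasure (b : ℝ) : Measure ℝ :=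
  (volume.restrict (Ici 0)).withDensity fun r =>
    ENNReal.ofReal (2 * Real.pi * b * r * Real.exp (-b * Real.pi * r ^ 2))

/-- The uplink model. `X 0, X 1, …` are the active users, enumerated by increasing distance to
the origin; they form a homogeneous Poisson process of intensity `lam`. User `n` carries the mark
`(B n, Rx n, G n)`: the thinning variable (retained with probability `p`), the distance to its own
base station (Rayleigh) and the fading coefficient (exponential with mean `1 / μ`). The marks are
i.i.d. with independent components, and independent of the user locations. -/
structure IsModel {Ω : Type*} [MeasurableSpace Ω] (P : Measure Ω) (lam : ℝ) (p : unitInterval)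
    (μ : ℝ) (X : ℕ → Ω → Plane) (B : ℕ → Ω → Bool) (Rx G : ℕ → Ω → ℝ) : Prop where
  measurable_X : ∀ n, Measurable (X n)
  measurable_B : ∀ n, Measurable (B n)
  measurable_Rx : ∀ n, Measurable (Rx n)
  measurable_G : ∀ n, Measurable (G n)
  poisson : IsPoissonProcess (fun ω => pointMeasure fun n => X n ω)
    (ENNReal.ofReal lam • volume) P
  ordered : ∀ᵐ ω ∂P, Monotone fun n => ‖X n ω‖
  hasLaw_mark : ∀ n, HasLaw (fun ω => (B n ω, Rx n ω, G n ω))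
    ((bernoulliMeasure true false p).prod
      ((rayleighMeasure ((p : ℝ) * lam)).prod (expMeasure μ))) P
  iIndep_mark : iIndepFun (fun n ω => (B n ω, Rx n ω, G n ω)) P
  indep_mark : IndepFun (fun ω n => X n ω) (fun ω n => (B n ω, Rx n ω, G n ω)) P

section Model

variable {Ω : Type*} (k : ℕ) (α ε : ℝ) (X : ℕ → Ω → Plane) (B : ℕ → Ω → Bool)
  (Rx G : ℕ → Ω → ℝ)

/-- Distance `R_k` of the `k`-th nearest user to the origin (`k ≥ 1`; it has index `k - 1`). -/
def servingDist (ω : Ω) : ℝ := ‖X (k - 1) ω‖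

/-- The interferers: retained users outside the closed ball of radius `R_k` about the origin. -/
def interferers (ω : Ω) : Set ℕ :=
  {n | X n ω ∉ Metric.closedBall (0 : Plane) (servingDist k X ω) ∧ B n ω = true}

/-- Power received at the origin from user `n` if it is an interferer, and `0` otherwise. -/
def interferenceTerm (ω : Ω) (n : ℕ) : ℝ :=
  (interferers k X B ω).indicator
    (fun n => G n ω * Rx n ω ^ (α * ε) * ‖X n ω‖ ^ (-α)) n

/-- The interference `I_k`. -/
def interference (ω : Ω) : ℝ := ∑' n, interferenceTerm k α ε X B Rx G ω n

/-- The SINR of the `k`-th user, with noise power `σ²`. -/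
def sinr (σ : ℝ) (ω : Ω) : ℝ :=
  G (k - 1) ω * servingDist k X ω ^ (α * (ε - 1)) /
    (interference k α ε X B Rx G ω + σ ^ 2)

/-- The Laplace transform at `s` of the interference conditioned on `R_k = r`. -/
def condLaplace [MeasurableSpace Ω] (P : Measure Ω) [IsFiniteMeasure P] (r s : ℝ) : ℝ :=
  ∫ x, Real.exp (-s * x)
    ∂(condDistrib (interference k α ε X B Rx G) (servingDist k X) P r)

/-- `ξ(r)`: the noise term times the conditional Laplace transform of the interference. -/
def xi [MeasurableSpace Ω] (P : Measure Ω) [IsFiniteMeasure P] (μ t σ r : ℝ) : ℝ :=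
  Real.exp (-μ * t * σ ^ 2 * r ^ (α * (1 - ε))) *
    condLaplace k α ε X B Rx G P r (μ * t * r ^ (α * (1 - ε)))

end Model

/-- The density of the distance to the `k`-th nearest point. -/
def distDensity (k : ℕ) (lam r : ℝ) : ℝ :=
  2 * ((lam * Real.pi) ^ k / (Nat.factorial (k - 1) : ℝ)) * r ^ (2 * k - 1) *
    Real.exp (-lam * Real.pi * r ^ 2)

/-- The integrand in `q` of the inner integral of the Laplace exponent. -/
def innerIntegrand (b t α ε r v q : ℝ) : ℝ :=
  Real.pi * b * Real.exp (-b * Real.pi * q) /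
    (1 + t * r ^ (α * (1 - ε)) * q ^ (α * ε / 2) * v ^ (-α))

/-- The integrand in `v` of the outer integral of the Laplace exponent. -/
def outerIntegrand (b t α ε r v : ℝ) : ℝ :=
  (1 - ∫ q in Ioi (0 : ℝ), innerIntegrand b t α ε r v q) * v

end Uplink

end

/-!
The users are points `X n` of a Poisson process, listed by increasing norm, and the users served are
the first `k` of them, so everything is a statement about what happens beyond the distance `R` of
the `k`-th nearest point.

The heart of the matter is the Markov property of the process at `R` (`lintegral_expNeg_outside`):
given `R = r`, the points at distance more than `r` are again a Poisson process. Since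
`{R ≤ c}` is the event that the closed ball of radius `c` holds at least `k` points, it is
independent of the points outside any closed ball of radius `b ≥ c`; rounding `R` up to a multiple
of `1 / m` reduces the random radius to countably many deterministic ones, and one lets `m → ∞`,
using that the Laplace functional of the points outside a ball is right continuous in the radius.
The Laplace functional itself is computed on simple functions, where it is a product of Laplace
transforms of Poisson variables, and extended by monotone convergence. Averaging over the
independent marks replaces the contribution of a point by its conditional Laplace transform
(`lintegral_expNeg_tsum_marks`).

Sums over the points are taken in `[0, ∞]`, where they always exist, and `expNeg x = e^{-x}` with
`e^{-∞} = 0` keeps the formulas true when they diverge. That the interference is finite then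
follows by letting the argument of its Laplace transform tend to `0`
(`IsModel.ae_totalPower_ne_top`), and that it is positive by giving every interferer infinite power
(`IsModel.ae_exists_interferer`).

For one user, integrating out the exponential fading gives `1 / (1 + c ρ^{αε} v^{-α})`, the
substitution `q = ρ²` in the Rayleigh law gives the inner integral, and polar coordinates give the
outer one. For each fixed argument this identifies the conditional Laplace transform for almost
every `r`; both sides are continuous in the argument, so the exceptional set may be chosen
independently of it, and the argument may depend on `r` (`IsModel.condLaplace_eq`).

Coverage says that the fading of the `k`-th user exceeds a multiple of interference plus noise. That
fading is exponential and independent of the serving distance and of the interference, to which the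
`k`-th user does not contribute, so the probability is the mean of an exponential
(`IsModel.measure_lt_sinr`), which is then disintegrated over `R`.
-/

noncomputable section

namespace Uplink

open Filter Topology ENNReal

/-! ### The Laplace functional of a Poisson process -/

section

/-- The function `x ↦ e^{-x}` from `[0, ∞]` to `[0, 1]`, with `e^{-∞} = 0`. -/
def expNeg (x : ℝ≥0∞) : ℝ≥0∞ := EReal.exp (-(x : EReal))

lemma continuous_expNeg : Continuous expNeg :=
  continuous_exp.comp (continuous_neg.comp continuous_coe_ennreal_ereal)

lemma measurable_expNeg : Measurable expNeg := continuous_expNeg.measurable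

lemma antitone_expNeg : Antitone expNeg := fun x y h => by
  unfold expNeg
  simpa using h

@[simp] lemma expNeg_zero : expNeg 0 = 1 := by simp [expNeg]

@[simp] lemma expNeg_top : expNeg ∞ = 0 := by simp [expNeg]

lemma expNeg_le_one (x : ℝ≥0∞) : expNeg x ≤ 1 := by
  simpa using antitone_expNeg (zero_le (a := x))

lemma expNeg_ne_top (x : ℝ≥0∞) : expNeg x ≠ ∞ := ((expNeg_le_one x).trans_lt one_lt_top).ne

lemma expNeg_add (x y : ℝ≥0∞) : expNeg (x + y) = expNeg x * expNeg y := by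
  unfold expNeg
  rw [← EReal.exp_add, EReal.coe_ennreal_add, EReal.neg_add, sub_eq_add_neg]
  · left; exact EReal.coe_ennreal_ne_bot _
  · right; exact EReal.coe_ennreal_ne_bot _

lemma expNeg_sum {ι : Type*} (s : Finset ι) (f : ι → ℝ≥0∞) :
    expNeg (∑ i ∈ s, f i) = ∏ i ∈ s, expNeg (f i) := by
  classical
  induction s using Finset.induction_on with
  | empty => simp
  | insert a s ha ih => rw [Finset.sum_insert ha, Finset.prod_insert ha, expNeg_add, ih]

lemma expNeg_ofReal {y : ℝ} (hy : 0 ≤ y) :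
    expNeg (ENNReal.ofReal y) = ENNReal.ofReal (Real.exp (-y)) := by
  unfold expNeg
  rw [EReal.coe_ennreal_ofReal, max_eq_left hy, ← EReal.coe_neg, EReal.exp_coe]

lemma expNeg_mul_natCast (c : ℝ≥0∞) (n : ℕ) : expNeg (c * n) = expNeg c ^ n := by
  induction n with
  | zero => simp
  | succ n ih => rw [Nat.cast_succ, mul_add, mul_one, expNeg_add, ih, pow_succ]

/-- The inverse of `expNeg` on `[0, 1]`. -/
def negLog (u : ℝ≥0∞) : ℝ≥0∞ := (-(ENNReal.log u)).toENNReal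

lemma measurable_negLog : Measurable negLog :=
  measurable_ereal_toENNReal.comp (measurable_neg.comp measurable_log)

lemma expNeg_negLog {u : ℝ≥0∞} (hu : u ≤ 1) : expNeg (negLog u) = u := by
  unfold expNeg negLog
  rw [EReal.coe_toENNReal, neg_neg, ENNReal.exp_log]
  rw [EReal.neg_nonneg]
  simpa using hu

/-- The Laplace transform of the Poisson law. -/
lemma lintegral_expNeg_poisson (r : NNReal) (c : ℝ≥0∞) :
    ∫⁻ n, expNeg (c * n) ∂((poissonMeasure r).map (Nat.cast : ℕ → ℝ≥0∞)) =
      expNeg (r * (1 - expNeg c)) := by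
  rw [lintegral_map (by exact measurable_expNeg.comp (measurable_const.mul measurable_id))
    (measurable_of_countable _)]
  simp only [expNeg_mul_natCast]
  obtain ⟨q, hq⟩ : ∃ q : NNReal, expNeg c = q := ⟨_, (ENNReal.coe_toNNReal (expNeg_ne_top c)).symm⟩
  have hq1 : (q : ℝ) ≤ 1 := by
    have := expNeg_le_one c
    rw [hq] at this
    exact_mod_cast this
  rw [lintegral_countable', hq]
  have h1 : ∀ n : ℕ, (q : ℝ≥0∞) ^ n * poissonMeasure r {n} =
      ENNReal.ofReal (Real.exp (-r) * ((r * q : ℝ) ^ n / (n.factorial : ℝ))) := by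
    intro n
    rw [poissonMeasure_singleton, ← ENNReal.ofReal_coe_nnreal, ← ENNReal.ofReal_pow q.coe_nonneg,
      ← ENNReal.ofReal_mul (by positivity)]
    congr 1
    rw [mul_pow]; ring
  have h2 : HasSum (fun n : ℕ => Real.exp (-r) * ((r * q : ℝ) ^ n / (n.factorial : ℝ)))
      (Real.exp (-r) * Real.exp (r * q)) := by
    have := NormedSpace.expSeries_div_hasSum_exp (𝔸 := ℝ) (r * q : ℝ)
    rw [← Real.exp_eq_exp_ℝ] at this
    exact this.mul_left _
  simp only [h1]
  rw [← ENNReal.ofReal_tsum_of_nonneg (fun n => by positivity) h2.summable, h2.tsum_eq,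
    ← Real.exp_add]
  have h3 : (r : ℝ≥0∞) * (1 - q) = ENNReal.ofReal (r * (1 - q)) := by
    rw [ENNReal.ofReal_mul r.coe_nonneg, ENNReal.ofReal_sub _ q.coe_nonneg, ENNReal.ofReal_one]
    simp
  rw [h3, expNeg_ofReal (mul_nonneg r.coe_nonneg (by linarith))]
  congr 2; ring

variable {Ω : Type*} [MeasurableSpace Ω] {P : Measure Ω} {N : Ω → Measure Plane}
  {Λ : Measure Plane}

lemma IsPoissonProcess.measurable_count (hN : IsPoissonProcess N Λ P) {A : Set Plane}
    (hA : MeasurableSet A) : Measurable fun ω => N ω A :=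
  (Measure.measurable_coe hA).comp hN.measurable

lemma IsPoissonProcess.measurable_lintegral (hN : IsPoissonProcess N Λ P) {w : Plane → ℝ≥0∞}
    (hw : Measurable w) : Measurable fun ω => ∫⁻ x, w x ∂(N ω) :=
  (Measure.measurable_lintegral hw).comp hN.measurable

lemma IsPoissonProcess.iIndepFun_count (hN : IsPoissonProcess N Λ P) {ι : Type*} [Fintype ι]
    {A : ι → Set Plane} (hA : ∀ i, MeasurableSet (A i))
    (hd : Pairwise fun i j => Disjoint (A i) (A j)) : iIndepFun (fun i ω => N ω (A i)) P := by
  have e := Fintype.equivFin ι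
  have := hN.indep_count _ (fun i => A (e.symm i)) (fun i => hA _)
    (fun i j hij => hd (e.symm.injective.ne hij))
  simpa using this.precomp e.injective

lemma IsPoissonProcess.lintegral_expNeg_count (hN : IsPoissonProcess N Λ P) {A : Set Plane}
    (hA : MeasurableSet A) (hΛ : Λ A ≠ ∞) (c : ℝ≥0∞) :
    ∫⁻ ω, expNeg (c * N ω A) ∂P = expNeg (Λ A * (1 - expNeg c)) := by
  have h := (hN.hasLaw_count A hA hΛ).lintegral_comp (f := fun n => expNeg (c * n))
    (measurable_expNeg.comp (measurable_const.mul measurable_id)).aemeasurable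
  rw [h, lintegral_expNeg_poisson, ENNReal.coe_toNNReal hΛ]

/-- The Laplace functional of a Poisson process at a simple function, together with the
independence of the number of points in a set on which the function vanishes. -/
lemma IsPoissonProcess.setLIntegral_expNeg_simpleFunc [IsProbabilityMeasure P]
    (hN : IsPoissonProcess N Λ P)
    {C : Set Plane} (hC : MeasurableSet C) {S : Set ℝ≥0∞} (hS : MeasurableSet S)
    (g : SimpleFunc Plane ℝ≥0∞) (hgC : ∀ x ∈ C, g x = 0) (hg : Λ {x | g x ≠ 0} ≠ ∞) :
    ∫⁻ ω in {ω | N ω C ∈ S}, expNeg (∫⁻ x, g x ∂(N ω)) ∂P =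
      P {ω | N ω C ∈ S} * expNeg (∫⁻ x, (1 - expNeg (g x)) ∂Λ) := by
  classical
  set s : Finset ℝ≥0∞ := g.range.filter (· ≠ 0) with hs
  -- the level sets of `g` at nonzero values, together with `C`, are pairwise disjoint
  set A : Option s → Set Plane := fun i => i.elim C fun y => g ⁻¹' {(y : ℝ≥0∞)} with hA
  have hAm : ∀ i, MeasurableSet (A i) := by
    rintro (_ | y)
    · exact hC
    · exact g.measurableSet_preimage _
  have hd : Pairwise fun i j => Disjoint (A i) (A j) := by
    have h0 : ∀ y : s, Disjoint C (g ⁻¹' {(y : ℝ≥0∞)}) := by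
      intro y
      rw [Set.disjoint_left]
      intro x hx hy
      have hy0 := (Finset.mem_filter.1 y.2).2
      rw [mem_preimage, hgC x hx] at hy
      exact hy0 hy.symm
    rintro (_ | y) (_ | z) hyz
    · exact absurd rfl hyz
    · exact h0 z
    · exact (h0 y).symm
    · refine Disjoint.preimage _ (Set.disjoint_singleton.2 fun h => hyz ?_)
      rw [Subtype.ext h]
  have hind := hN.iIndepFun_count hAm hd
  have hAfin : ∀ y : s, Λ (g ⁻¹' {(y : ℝ≥0∞)}) ≠ ∞ := by
    intro y
    refine ne_top_of_le_ne_top hg (measure_mono fun x hx => ?_)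
    rw [mem_preimage, mem_singleton_iff] at hx
    rw [mem_ofPred_eq, hx]
    exact (Finset.mem_filter.1 y.2).2
  have hint : ∀ (ν : Measure Plane) (f : ℝ≥0∞ → ℝ≥0∞), f 0 = 0 →
      ∫⁻ x, f (g x) ∂ν = ∑ y : s, f y * ν (g ⁻¹' {(y : ℝ≥0∞)}) := by
    intro ν f hf
    have h0 : ∫⁻ x, f (g x) ∂ν = (g.map f).lintegral ν := by
      rw [← SimpleFunc.lintegral_eq_lintegral]; rfl
    rw [h0, SimpleFunc.map_lintegral]
    rw [Finset.sum_coe_sort s (fun y => f y * ν (g ⁻¹' {y})), hs, Finset.sum_filter]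
    refine Finset.sum_congr rfl fun y _ => ?_
    by_cases hy : y = 0
    · simp [hy, hf]
    · simp [hy]
  have hF : ∀ i : Option s, Measurable (i.elim (S.indicator 1) fun y n => expNeg (y * n) :
      ℝ≥0∞ → ℝ≥0∞) := by
    rintro (_ | y)
    · exact measurable_one.indicator hS
    · exact measurable_expNeg.comp (measurable_const.mul measurable_id)
  have hprod := lintegral_prod_eq_prod_lintegral_of_indepFun Finset.univ
    (fun (i : Option s) ω => (i.elim (S.indicator 1) fun y n => expNeg (y * n) :
      ℝ≥0∞ → ℝ≥0∞) (N ω (A i)))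
    (hind.comp _ hF) (fun i => (hF i).comp (hN.measurable_count (hAm i)))
  simp only [Fintype.prod_option, Option.elim, hA] at hprod
  have hSm : MeasurableSet {ω | N ω C ∈ S} := hN.measurable_count hC hS
  have hL : ∫⁻ ω in {ω | N ω C ∈ S}, expNeg (∫⁻ x, g x ∂(N ω)) ∂P =
      ∫⁻ ω, S.indicator 1 (N ω C) * ∏ y : s, expNeg (y * N ω (g ⁻¹' {(y : ℝ≥0∞)})) ∂P := by
    rw [← lintegral_indicator hSm]
    refine lintegral_congr fun ω => ?_
    have h0 := hint (N ω) (fun y => y) rfl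
    rw [← expNeg_sum, ← h0]
    by_cases h : N ω C ∈ S <;> simp [h, indicator]
  rw [hL, hprod, hint Λ (fun y => 1 - expNeg y) (by simp), expNeg_sum]
  congr 1
  · have : (fun ω => S.indicator (1 : ℝ≥0∞ → ℝ≥0∞) (N ω C)) =
        {ω | N ω C ∈ S}.indicator 1 := by
      ext ω; by_cases h : N ω C ∈ S <;> simp [h, indicator]
    rw [this, lintegral_indicator_one hSm]
  · refine Finset.prod_congr rfl fun y _ => ?_
    rw [hN.lintegral_expNeg_count (g.measurableSet_preimage _) (hAfin y), mul_comm]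

/-- The Laplace functional of a Poisson process at a function vanishing on `C`, together with its
independence of the number of points in `C`. -/
theorem IsPoissonProcess.setLIntegral_expNeg [IsProbabilityMeasure P] [SigmaFinite Λ]
    (hN : IsPoissonProcess N Λ P)
    {C : Set Plane} (hC : MeasurableSet C) {S : Set ℝ≥0∞} (hS : MeasurableSet S)
    {w : Plane → ℝ≥0∞} (hw : Measurable w) (hwC : ∀ x ∈ C, w x = 0) :
    ∫⁻ ω in {ω | N ω C ∈ S}, expNeg (∫⁻ x, w x ∂(N ω)) ∂P =
      P {ω | N ω C ∈ S} * expNeg (∫⁻ x, (1 - expNeg (w x)) ∂Λ) := by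
  -- the law of a count is only prescribed on sets of finite intensity, hence the restriction
  set g : ℕ → SimpleFunc Plane ℝ≥0∞ := fun n =>
    (SimpleFunc.eapprox w n).restrict (spanningSets Λ n) with hg
  have hgv : ∀ n x, g n x = (spanningSets Λ n).indicator (SimpleFunc.eapprox w n) x := fun n x => by
    rw [hg, SimpleFunc.restrict_apply _ (measurableSet_spanningSets Λ n)]
  have hgle : ∀ n x, g n x ≤ w x := by
    intro n x
    rw [hgv]
    refine (indicator_le_self _ _ x).trans ?_
    rw [← SimpleFunc.iSup_eapprox_apply hw x]
    exact le_iSup (fun n => SimpleFunc.eapprox w n x) n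
  have hmono : ∀ x, Monotone fun n => g n x := by
    intro x m n hmn
    simp only [hgv]
    by_cases hx : x ∈ spanningSets Λ m
    · rw [indicator_of_mem hx, indicator_of_mem (monotone_spanningSets Λ hmn hx)]
      exact SimpleFunc.monotone_eapprox w hmn x
    · rw [indicator_of_notMem hx]; exact zero_le
  have hlim : ∀ x, Tendsto (fun n => g n x) atTop (𝓝 (w x)) := by
    intro x
    have h1 : Tendsto (fun n => SimpleFunc.eapprox w n x) atTop (𝓝 (w x)) := by
      rw [← SimpleFunc.iSup_eapprox_apply hw x]
      exact tendsto_atTop_iSup fun m n hmn => SimpleFunc.monotone_eapprox w hmn x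
    refine h1.congr' ?_
    filter_upwards [eventually_ge_atTop (spanningSetsIndex Λ x)] with n hn
    rw [hgv, indicator_of_mem]
    exact monotone_spanningSets Λ hn (mem_spanningSetsIndex Λ x)
  have key : ∀ n, ∫⁻ ω in {ω | N ω C ∈ S}, expNeg (∫⁻ x, g n x ∂(N ω)) ∂P =
      P {ω | N ω C ∈ S} * expNeg (∫⁻ x, (1 - expNeg (g n x)) ∂Λ) := by
    intro n
    refine hN.setLIntegral_expNeg_simpleFunc hC hS (g n) (fun x hx => ?_) ?_
    · exact le_antisymm ((hgle n x).trans (hwC x hx).le) zero_le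
    · refine ne_top_of_le_ne_top (measure_spanningSets_lt_top Λ n).ne (measure_mono fun x hx => ?_)
      by_contra h
      exact hx (by rw [hgv, indicator_of_notMem h])
  have hL : Tendsto (fun n => ∫⁻ ω in {ω | N ω C ∈ S}, expNeg (∫⁻ x, g n x ∂(N ω)) ∂P) atTop
      (𝓝 (∫⁻ ω in {ω | N ω C ∈ S}, expNeg (∫⁻ x, w x ∂(N ω)) ∂P)) := by
    refine tendsto_lintegral_of_dominated_convergence (fun _ => 1) (fun n => ?_)
      (fun n => Eventually.of_forall fun ω => expNeg_le_one _) (by simp)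
      (Eventually.of_forall fun ω => ?_)
    · exact measurable_expNeg.comp (hN.measurable_lintegral (g n).measurable)
    · refine (continuous_expNeg.tendsto _).comp ?_
      exact lintegral_tendsto_of_tendsto_of_monotone (fun n => (g n).measurable.aemeasurable)
        (Eventually.of_forall hmono) (Eventually.of_forall hlim)
  have hR : Tendsto (fun n => P {ω | N ω C ∈ S} * expNeg (∫⁻ x, (1 - expNeg (g n x)) ∂Λ)) atTop
      (𝓝 (P {ω | N ω C ∈ S} * expNeg (∫⁻ x, (1 - expNeg (w x)) ∂Λ))) := by
    refine ENNReal.Tendsto.const_mul ((continuous_expNeg.tendsto _).comp ?_)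
      (Or.inr (measure_ne_top _ _))
    refine lintegral_tendsto_of_tendsto_of_monotone
      (fun n => (measurable_const.sub (measurable_expNeg.comp (g n).measurable)).aemeasurable)
      (Eventually.of_forall fun x m n hmn => tsub_le_tsub_left (antitone_expNeg (hmono x hmn)) 1)
      (Eventually.of_forall fun x => ?_)
    exact ENNReal.Tendsto.sub tendsto_const_nhds ((continuous_expNeg.tendsto _).comp (hlim x))
      (Or.inl one_ne_top)
  exact tendsto_nhds_unique hL (by simpa only [key] using hR)

end

/-! ### The Markov property at the distance of the nearest points -/

section

lemma lintegral_pointMeasure (x : ℕ → Plane) {w : Plane → ℝ≥0∞} (hw : Measurable w) :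
    ∫⁻ y, w y ∂(pointMeasure x) = ∑' n, w (x n) := by
  rw [pointMeasure, lintegral_sum_measure]
  simp only [lintegral_dirac' _ hw]

lemma pointMeasure_apply (x : ℕ → Plane) {A : Set Plane} (hA : MeasurableSet A) :
    pointMeasure x A = ∑' n, A.indicator 1 (x n) := by
  rw [← lintegral_indicator_one hA, lintegral_pointMeasure x (measurable_one.indicator hA)]

/-- For points listed by increasing norm, the `j`-th one lies in a closed ball about the origin iff
the ball contains at least `j + 1` points. -/
lemma norm_le_iff_le_pointMeasure {x : ℕ → Plane} (hx : Monotone fun n => ‖x n‖) (j : ℕ) (c : ℝ) :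
    ‖x j‖ ≤ c ↔ ((j + 1 : ℕ) : ℝ≥0∞) ≤ pointMeasure x (Metric.closedBall 0 c) := by
  rw [pointMeasure_apply x Metric.isClosed_closedBall.measurableSet]
  constructor
  · intro h
    refine le_trans ?_ (ENNReal.sum_le_tsum (Finset.range (j + 1)))
    rw [Finset.sum_congr rfl (g := fun _ => (1 : ℝ≥0∞))]
    · simp
    · intro n hn
      rw [indicator_of_mem]
      · rfl
      · rw [mem_closedBall_zero_iff]
        exact (hx (Nat.lt_succ_iff.1 (Finset.mem_range.1 hn))).trans h
  · intro h
    by_contra! hc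
    rw [tsum_eq_sum (s := Finset.range j)] at h
    · have h2 : ∑ n ∈ Finset.range j, (Metric.closedBall (0 : Plane) c).indicator 1 (x n) ≤
          (j : ℝ≥0∞) := by
        refine (Finset.sum_le_card_nsmul _ _ 1 fun n _ => ?_).trans (by simp)
        exact indicator_le_self _ _ _
      have := h.trans h2
      norm_cast at this
      omega
    · intro n hn
      rw [indicator_of_notMem]
      rw [mem_closedBall_zero_iff, not_le]
      exact hc.trans_le (hx (not_lt.1 fun h => hn (Finset.mem_range.2 h)))

/-- The points at distance more than `r` from the origin. -/
def outside (r : ℝ) : Set Plane := {x | r < ‖x‖}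

lemma measurableSet_outside (r : ℝ) : MeasurableSet (outside r) :=
  measurableSet_lt measurable_const measurable_norm

/-- Right continuity in the radius; the lower bound is Fatou's lemma. -/
lemma tendsto_setLIntegral_outside (ν : Measure Plane) {w : Plane → ℝ≥0∞} (hw : Measurable w)
    {b : ℕ → ℝ} {r : ℝ} (hb : Tendsto b atTop (𝓝 r)) (hr : ∀ m, r ≤ b m) :
    Tendsto (fun m => ∫⁻ x in outside (b m), w x ∂ν) atTop (𝓝 (∫⁻ x in outside r, w x ∂ν)) := by
  refine tendsto_of_le_liminf_of_limsup_le ?_ ?_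
  · simp only [← lintegral_indicator (measurableSet_outside _)]
    refine le_trans (lintegral_mono fun x => ?_)
      (lintegral_liminf_le fun m => hw.indicator (measurableSet_outside _))
    by_cases hx : x ∈ outside r
    · refine le_liminf_of_le (by isBoundedDefault) ?_
      filter_upwards [hb.eventually_lt_const hx] with m hm
      rw [indicator_of_mem hx, indicator_of_mem (show x ∈ outside (b m) from hm)]
    · rw [indicator_of_notMem hx]; exact zero_le
  · refine limsup_le_of_le (by isBoundedDefault) (Eventually.of_forall fun m => ?_)
    exact lintegral_mono_set fun x (hx : b m < ‖x‖) => (hr m).trans_lt hx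

variable {Ω : Type*} [MeasurableSpace Ω] {P : Measure Ω} {X : ℕ → Ω → Plane} {Λ : Measure Plane}

lemma measurable_eval_nat {T : Ω → ℕ} (hT : Measurable T) {F : ℕ → Ω → ℝ≥0∞}
    (hF : ∀ i, Measurable (F i)) : Measurable fun ω => F (T ω) ω := by
  have h : Measurable fun q : ℕ × Ω => F q.1 q.2 := measurable_from_prod_countable_right hF
  exact h.comp (hT.prodMk measurable_id)

lemma measurable_setLIntegral_outside (hN : IsPoissonProcess (fun ω => pointMeasure (X · ω)) Λ P)
    {w : Plane → ℝ≥0∞} (hw : Measurable w) (b : ℝ) :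
    Measurable fun ω => ∫⁻ x in outside b, w x ∂(pointMeasure (X · ω)) := by
  simp only [← lintegral_indicator (measurableSet_outside _)]
  exact hN.measurable_lintegral (hw.indicator (measurableSet_outside _))

lemma lintegral_eq_tsum_fiber {T : Ω → ℕ} (hT : Measurable T) {F : ℕ → Ω → ℝ≥0∞}
    (hF : ∀ i, Measurable (F i)) :
    ∫⁻ ω, F (T ω) ω ∂P = ∑' i, ∫⁻ ω in {ω | T ω = i}, F i ω ∂P := by
  have hm : ∀ i, MeasurableSet {ω | T ω = i} := fun i => hT (measurableSet_singleton i)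
  simp only [← lintegral_indicator (hm _)]
  rw [← lintegral_tsum fun i => ((hF i).indicator (hm i)).aemeasurable]
  refine lintegral_congr fun ω => ?_
  rw [tsum_eq_single (T ω)]
  · rw [indicator_of_mem]; rfl
  · intro i hi
    rw [indicator_of_notMem]
    exact fun h => hi h.symm

variable [IsProbabilityMeasure P] [SigmaFinite Λ]

/-- Restricted to the event that the `j`-th nearest point (counted from `0`) lies in the closed
ball of radius `b`, its distance is independent of the points outside that ball. -/
lemma setLIntegral_expNeg_outside_fixed (hX : ∀ n, Measurable (X n))
    (hN : IsPoissonProcess (fun ω => pointMeasure (X · ω)) Λ P)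
    (ho : ∀ᵐ ω ∂P, Monotone fun n => ‖X n ω‖) (j : ℕ) {w : Plane → ℝ≥0∞} (hw : Measurable w)
    {h : ℝ → ℝ≥0∞} (hh : Measurable h) (b : ℝ) :
    ∫⁻ ω in {ω | ‖X j ω‖ ≤ b}, h ‖X j ω‖ *
        expNeg (∫⁻ x in outside b, w x ∂(pointMeasure (X · ω))) ∂P =
      (∫⁻ ω in {ω | ‖X j ω‖ ≤ b}, h ‖X j ω‖ ∂P) *
        expNeg (∫⁻ x in outside b, (1 - expNeg (w x)) ∂Λ) := by
  set Z : Ω → ℝ≥0∞ := fun ω => expNeg (∫⁻ x in outside b, w x ∂(pointMeasure (X · ω))) with hZ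
  set W : ℝ≥0∞ := expNeg (∫⁻ x in outside b, (1 - expNeg (w x)) ∂Λ) with hW
  have hZm : Measurable Z := measurable_expNeg.comp (measurable_setLIntegral_outside hN hw b)
  have hR : Measurable fun ω => ‖X j ω‖ := (hX j).norm
  have hfin : ∫⁻ ω in {ω | ‖X j ω‖ ≤ b}, Z ω ∂P ≠ ∞ := by
    refine ne_top_of_le_ne_top (measure_ne_top P {ω | ‖X j ω‖ ≤ b}) ?_
    refine (lintegral_mono fun ω => expNeg_le_one _).trans (by simp)
  have : IsFiniteMeasure ((P.restrict {ω | ‖X j ω‖ ≤ b}).withDensity Z) :=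
    isFiniteMeasure_withDensity hfin
  -- the two sides are measures in `h`, which are compared on the half-lines `Iic c`
  have hmeas : ((P.restrict {ω | ‖X j ω‖ ≤ b}).withDensity Z).map (fun ω => ‖X j ω‖) =
      W • (P.restrict {ω | ‖X j ω‖ ≤ b}).map (fun ω => ‖X j ω‖) := by
    refine Measure.ext_of_Iic _ _ fun c => ?_
    have hm : MeasurableSet ((fun ω => ‖X j ω‖) ⁻¹' Iic c) := hR measurableSet_Iic
    rw [Measure.map_apply hR measurableSet_Iic, withDensity_apply _ hm, Measure.smul_apply,
      Measure.map_apply hR measurableSet_Iic, smul_eq_mul, Measure.restrict_apply hm,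
      Measure.restrict_restrict hm]
    have hset : (fun ω => ‖X j ω‖) ⁻¹' Iic c ∩ {ω | ‖X j ω‖ ≤ b} = {ω | ‖X j ω‖ ≤ min c b} := by
      ext ω; simp
    rw [hset]
    have hae : {ω | ‖X j ω‖ ≤ min c b} =ᵐ[P] {ω | pointMeasure (X · ω)
        (Metric.closedBall 0 (min c b)) ∈ Ici ((j + 1 : ℕ) : ℝ≥0∞)} := by
      filter_upwards [ho] with ω hω
      exact propext (norm_le_iff_le_pointMeasure hω j (min c b))
    rw [setLIntegral_congr hae, measure_congr hae]
    have := hN.setLIntegral_expNeg (C := Metric.closedBall 0 (min c b))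
      Metric.isClosed_closedBall.measurableSet
      (measurableSet_Ici (a := ((j + 1 : ℕ) : ℝ≥0∞))) (w := (outside b).indicator w)
      (hw.indicator (measurableSet_outside b)) (fun x hx => ?_)
    · rw [mul_comm, hW, ← lintegral_indicator (measurableSet_outside b)]
      simp only [hZ, ← lintegral_indicator (measurableSet_outside b)]
      rw [this]
      congr 3
      ext x
      by_cases hx : x ∈ outside b <;> simp [hx]
    · rw [indicator_of_notMem]
      rw [mem_closedBall_zero_iff] at hx
      exact not_lt.2 (hx.trans (min_le_right _ _))
  have h1 := congrArg (fun m => ∫⁻ r, h r ∂m) hmeas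
  have h2 := lintegral_withDensity_eq_lintegral_mul (P.restrict {ω | ‖X j ω‖ ≤ b}) hZm (hh.comp hR)
  simp only [Function.comp_def] at h2
  rw [lintegral_map hh hR, lintegral_smul_measure, lintegral_map hh hR, h2, smul_eq_mul,
    mul_comm W] at h1
  rw [← h1]
  exact lintegral_congr fun ω => mul_comm _ _

/-- The Markov property of a Poisson process at the distance of its `j`-th nearest point (counted
from `0`): given
this distance, the points further away form a Poisson process. The distance is approximated from
the right by its values rounded up to multiples of `1 / m`. -/
theorem lintegral_expNeg_outside (hX : ∀ n, Measurable (X n))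
    (hN : IsPoissonProcess (fun ω => pointMeasure (X · ω)) Λ P)
    (ho : ∀ᵐ ω ∂P, Monotone fun n => ‖X n ω‖) (j : ℕ) {w : Plane → ℝ≥0∞} (hw : Measurable w)
    {A : Set ℝ} (hA : MeasurableSet A) :
    ∫⁻ ω in {ω | ‖X j ω‖ ∈ A},
        expNeg (∫⁻ x in outside ‖X j ω‖, w x ∂(pointMeasure (X · ω))) ∂P =
      ∫⁻ ω in {ω | ‖X j ω‖ ∈ A},
        expNeg (∫⁻ x in outside ‖X j ω‖, (1 - expNeg (w x)) ∂Λ) ∂P := by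
  have hR : Measurable fun ω => ‖X j ω‖ := (hX j).norm
  set T : ℕ → Ω → ℕ := fun m ω => ⌈((m : ℝ) + 1) * ‖X j ω‖⌉₊ with hTdef
  have hT : ∀ m, Measurable (T m) := fun m => Nat.measurable_ceil.comp (hR.const_mul _)
  set b : ℕ → Ω → ℝ := fun m ω => (T m ω : ℝ) / ((m : ℝ) + 1) with hbdef
  have hm0 : ∀ m : ℕ, (0 : ℝ) < (m : ℝ) + 1 := fun m => by positivity
  have hb1 : ∀ m ω, ‖X j ω‖ ≤ b m ω := fun m ω => by
    rw [hbdef, le_div_iff₀ (hm0 m), mul_comm]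
    exact Nat.le_ceil _
  have hb2 : ∀ ω, Tendsto (fun m => b m ω) atTop (𝓝 ‖X j ω‖) := by
    intro ω
    have h1 : Tendsto (fun m : ℕ => ‖X j ω‖ + 1 / ((m : ℝ) + 1)) atTop (𝓝 ‖X j ω‖) := by
      simpa using tendsto_const_nhds.add (tendsto_one_div_add_atTop_nhds_zero_nat (𝕜 := ℝ))
    refine tendsto_of_tendsto_of_tendsto_of_le_of_le tendsto_const_nhds h1 (fun m => hb1 m ω)
      fun m => ?_
    simp only [hbdef]
    rw [div_le_iff₀ (hm0 m), add_mul, one_div_mul_cancel (hm0 m).ne', mul_comm]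
    exact (Nat.ceil_lt_add_one (by positivity)).le
  set Z : ℝ → Ω → ℝ≥0∞ := fun r ω => expNeg (∫⁻ x in outside r, w x ∂(pointMeasure (X · ω)))
  set W : ℝ → ℝ≥0∞ := fun r => expNeg (∫⁻ x in outside r, (1 - expNeg (w x)) ∂Λ)
  have hw' : Measurable fun x => 1 - expNeg (w x) :=
    measurable_const.sub (measurable_expNeg.comp hw)
  have hZm : ∀ r, Measurable (Z r) := fun r =>
    measurable_expNeg.comp (measurable_setLIntegral_outside hN hw r)
  -- `b m ω` is `‖X j ω‖` rounded up: the event `b m = i / (m + 1)` is then determined by the points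
  -- within the radius `i / (m + 1)`, and so is independent of the points outside it
  have key : ∀ m, ∫⁻ ω in {ω | ‖X j ω‖ ∈ A}, Z (b m ω) ω ∂P =
      ∫⁻ ω in {ω | ‖X j ω‖ ∈ A}, W (b m ω) ∂P := by
    intro m
    rw [lintegral_eq_tsum_fiber (P := P.restrict {ω | ‖X j ω‖ ∈ A}) (hT m)
        (F := fun i => Z ((i : ℝ) / ((m : ℝ) + 1))) (fun i => hZm _),
      lintegral_eq_tsum_fiber (P := P.restrict {ω | ‖X j ω‖ ∈ A}) (hT m)
        (F := fun i _ => W ((i : ℝ) / ((m : ℝ) + 1))) (fun i => measurable_const)]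
    congr 1
    ext i
    set B : Set ℝ := A ∩ {r | ⌈((m : ℝ) + 1) * r⌉₊ = i} with hB
    have hBm : MeasurableSet B :=
      hA.inter ((Nat.measurable_ceil.comp (measurable_id.const_mul _)) (measurableSet_singleton i))
    have hTi : MeasurableSet {ω | T m ω = i} := hT m (measurableSet_singleton i)
    rw [Measure.restrict_restrict hTi]
    have hset : {ω | T m ω = i} ∩ {ω | ‖X j ω‖ ∈ A} =
        {ω | ‖X j ω‖ ∈ B} ∩ {ω | ‖X j ω‖ ≤ (i : ℝ) / ((m : ℝ) + 1)} := by
      ext ω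
      constructor
      · rintro ⟨h1, h2⟩
        refine ⟨⟨h2, h1⟩, ?_⟩
        have := hb1 m ω
        simp only [hbdef] at this
        rwa [show T m ω = i from h1] at this
      · rintro ⟨⟨h1, h2⟩, -⟩
        exact ⟨h2, h1⟩
    have hBm' : MeasurableSet {ω | ‖X j ω‖ ∈ B} := hR hBm
    have h0 := setLIntegral_expNeg_outside_fixed hX hN ho j hw
      (h := B.indicator 1) (measurable_one.indicator hBm) ((i : ℝ) / ((m : ℝ) + 1))
    have hind : ∀ (F : Ω → ℝ≥0∞), ∫⁻ ω in {ω | ‖X j ω‖ ≤ (i : ℝ) / ((m : ℝ) + 1)},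
        B.indicator 1 ‖X j ω‖ * F ω ∂P =
        ∫⁻ ω in {ω | T m ω = i} ∩ {ω | ‖X j ω‖ ∈ A}, F ω ∂P := by
      intro F
      rw [hset, ← Measure.restrict_restrict hBm', ← lintegral_indicator hBm']
      refine lintegral_congr fun ω => ?_
      by_cases h : ‖X j ω‖ ∈ B <;> simp [h, indicator]
    rw [hind] at h0
    rw [h0]
    have h1 := hind 1
    simp only [Pi.one_apply, mul_one] at h1
    rw [h1, lintegral_one, lintegral_const, mul_comm]
  have hL : Tendsto (fun m => ∫⁻ ω in {ω | ‖X j ω‖ ∈ A}, Z (b m ω) ω ∂P) atTop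
      (𝓝 (∫⁻ ω in {ω | ‖X j ω‖ ∈ A}, Z ‖X j ω‖ ω ∂P)) := by
    refine tendsto_lintegral_of_dominated_convergence (fun _ => 1) (fun m => ?_)
      (fun n => Eventually.of_forall fun ω => expNeg_le_one _) (by simp)
      (Eventually.of_forall fun ω => ?_)
    · exact measurable_eval_nat (hT m) fun i => hZm ((i : ℝ) / ((m : ℝ) + 1))
    · exact (continuous_expNeg.tendsto _).comp
        (tendsto_setLIntegral_outside _ hw (hb2 ω) fun m => hb1 m ω)
  have hRt : Tendsto (fun m => ∫⁻ ω in {ω | ‖X j ω‖ ∈ A}, W (b m ω) ∂P) atTop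
      (𝓝 (∫⁻ ω in {ω | ‖X j ω‖ ∈ A}, W ‖X j ω‖ ∂P)) := by
    refine tendsto_lintegral_of_dominated_convergence (fun _ => 1) (fun m => ?_)
      (fun n => Eventually.of_forall fun ω => expNeg_le_one _) (by simp)
      (Eventually.of_forall fun ω => ?_)
    · exact measurable_eval_nat (hT m) (F := fun i _ => W ((i : ℝ) / ((m : ℝ) + 1)))
        fun i => measurable_const
    · exact (continuous_expNeg.tendsto _).comp
        (tendsto_setLIntegral_outside _ hw' (hb2 ω) fun m => hb1 m ω)
  exact tendsto_nhds_unique hL (by simpa only [key] using hRt)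

end

/-! ### Independent marks -/

section

lemma lintegral_comp_prodMk_of_indepFun {Ω 𝓧 𝓨 : Type*} [MeasurableSpace Ω] [MeasurableSpace 𝓧]
    [MeasurableSpace 𝓨] {P : Measure Ω} [IsProbabilityMeasure P] {X : Ω → 𝓧} {Y : Ω → 𝓨}
    (hX : Measurable X) (hY : Measurable Y) (h : IndepFun X Y P) {F : 𝓧 × 𝓨 → ℝ≥0∞}
    (hF : Measurable F) :
    ∫⁻ ω, F (X ω, Y ω) ∂P = ∫⁻ ω, ∫⁻ ω', F (X ω, Y ω') ∂P ∂P := by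
  have : IsProbabilityMeasure (P.map Y) := Measure.isProbabilityMeasure_map hY.aemeasurable
  have h1 := (indepFun_iff_map_prod_eq_prod_map_map hX.aemeasurable hY.aemeasurable).1 h
  rw [← lintegral_map (f := F) hF (hX.prodMk hY), h1, lintegral_prod _ hF.aemeasurable,
    lintegral_map hF.lintegral_prod_right' hX]
  refine lintegral_congr fun ω => ?_
  exact lintegral_map (f := fun y => F (X ω, y)) (hF.comp measurable_prodMk_left) hY

variable {Ω : Type*} [MeasurableSpace Ω] {P : Measure Ω} [IsProbabilityMeasure P]
  {X : ℕ → Ω → Plane} {Λ : Measure Plane} [SigmaFinite Λ]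
  {𝓜 : Type*} [MeasurableSpace 𝓜] {M : ℕ → Ω → 𝓜} {ν : Measure 𝓜} [IsProbabilityMeasure ν]

lemma measurable_indicator_outside {𝓨 : Type*} [MeasurableSpace 𝓨] {r : 𝓨 → ℝ} (hr : Measurable r)
    {x : 𝓨 → Plane} (hx : Measurable x) {f : 𝓨 → Plane → ℝ≥0∞}
    (hf : Measurable fun y => f y (x y)) :
    Measurable fun y => (outside (r y)).indicator (f y) (x y) := by
  have h : (fun y => (outside (r y)).indicator (f y) (x y)) =
      {y | r y < ‖x y‖}.indicator fun y => f y (x y) := by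
    ext y
    by_cases hy : r y < ‖x y‖
    · rw [indicator_of_mem (show y ∈ {y | r y < ‖x y‖} from hy), indicator_of_mem]
      exact hy
    · rw [indicator_of_notMem (show y ∉ {y | r y < ‖x y‖} from hy), indicator_of_notMem]
      exact hy
  rw [h]
  exact hf.indicator (measurableSet_lt hr hx.norm)

/-- Averaging over the marks of finitely many points. -/
lemma lintegral_expNeg_sum_marks (hX : ∀ n, Measurable (X n)) (hM : ∀ n, Measurable (M n))
    (hMlaw : ∀ n, HasLaw (M n) ν P) (hMi : iIndepFun M P)
    (hXM : IndepFun (fun ω n => X n ω) (fun ω n => M n ω) P) (j : ℕ)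
    {g : Plane × 𝓜 → ℝ≥0∞} (hg : Measurable g) {A : Set ℝ} (hA : MeasurableSet A) (n : ℕ) :
    ∫⁻ ω in {ω | ‖X j ω‖ ∈ A}, expNeg (∑ i ∈ Finset.range n,
        (outside ‖X j ω‖).indicator (fun x => g (x, M i ω)) (X i ω)) ∂P =
      ∫⁻ ω in {ω | ‖X j ω‖ ∈ A}, expNeg (∑ i ∈ Finset.range n,
        (outside ‖X j ω‖).indicator (fun x => negLog (∫⁻ m, expNeg (g (x, m)) ∂ν)) (X i ω)) ∂P := by
  have hAm : MeasurableSet {ω | ‖X j ω‖ ∈ A} := (hX j).norm hA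
  set F : (ℕ → Plane) × (ℕ → 𝓜) → ℝ≥0∞ := fun q => A.indicator 1 ‖q.1 j‖ *
    expNeg (∑ i ∈ Finset.range n, (outside ‖q.1 j‖).indicator (fun x => g (x, q.2 i)) (q.1 i))
    with hF
  have hx : ∀ i, Measurable fun q : (ℕ → Plane) × (ℕ → 𝓜) => q.1 i := fun i =>
    (measurable_pi_apply i).comp measurable_fst
  have hm : ∀ i, Measurable fun q : (ℕ → Plane) × (ℕ → 𝓜) => q.2 i := fun i =>
    (measurable_pi_apply i).comp measurable_snd
  have hFm : Measurable F := by
    refine ((measurable_one.indicator hA).comp (hx j).norm).mul (measurable_expNeg.comp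
      (Finset.measurable_sum _ fun i _ => ?_))
    exact measurable_indicator_outside (hx j).norm (hx i)
      (f := fun q x => g (x, q.2 i)) (hg.comp ((hx i).prodMk (hm i)))
  have hu1 : ∀ x, ∫⁻ m, expNeg (g (x, m)) ∂ν ≤ 1 := fun x =>
    (lintegral_mono fun m => expNeg_le_one _).trans (by simp)
  have hind : ∀ G : Ω → ℝ≥0∞, ∫⁻ ω in {ω | ‖X j ω‖ ∈ A}, G ω ∂P =
      ∫⁻ ω, A.indicator 1 ‖X j ω‖ * G ω ∂P := by
    intro G
    rw [← lintegral_indicator hAm]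
    refine lintegral_congr fun ω => ?_
    by_cases h : ‖X j ω‖ ∈ A <;> simp [h, indicator]
  rw [hind, hind]
  have h1 := lintegral_comp_prodMk_of_indepFun (measurable_pi_lambda _ hX)
    (measurable_pi_lambda _ hM) hXM hFm
  simp only [hF] at h1
  rw [h1]
  refine lintegral_congr fun ω => ?_
  set f : ℕ → 𝓜 → ℝ≥0∞ := fun i m =>
    expNeg ((outside ‖X j ω‖).indicator (fun x => g (x, m)) (X i ω)) with hf
  have hfm : ∀ i, Measurable (f i) := fun i => by
    refine measurable_expNeg.comp ?_
    exact measurable_indicator_outside measurable_const measurable_const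
      (f := fun m x => g (x, m)) (hg.comp measurable_prodMk_left)
  have h2 : Measurable fun ω' => ∏ i ∈ Finset.range n, f i (M i ω') :=
    Finset.measurable_prod _ fun i _ => (hfm i).comp (hM i)
  simp only [expNeg_sum]
  rw [lintegral_const_mul _ h2]
  congr 1
  have h3 := (hMi.comp f hfm).precomp (g := fun i : Fin n => (i : ℕ)) Fin.val_injective
  have h4 := lintegral_prod_eq_prod_lintegral_of_indepFun Finset.univ
    (fun (i : Fin n) ω' => f i (M i ω')) h3 (fun i => (hfm i).comp (hM i))
  rw [← Fin.prod_univ_eq_prod_range (fun i => expNeg ((outside ‖X j ω‖).indicator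
    (fun x => negLog (∫⁻ m, expNeg (g (x, m)) ∂ν)) (X i ω)))]
  simp only [← Fin.prod_univ_eq_prod_range (fun i => f i (M i _))]
  rw [h4]
  refine Finset.prod_congr rfl fun i _ => ?_
  rw [(hMlaw i).lintegral_comp (hfm i).aemeasurable]
  by_cases hi : X i ω ∈ outside ‖X j ω‖
  · simp only [hf, indicator_of_mem hi]
    rw [expNeg_negLog (hu1 _)]
  · simp [hf, indicator_of_notMem hi]

/-- The Laplace functional of an independently marked Poisson process beyond its `j`-th nearest
point, on events determined by the distance of that point. -/
theorem lintegral_expNeg_tsum_marks (hX : ∀ n, Measurable (X n))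
    (hN : IsPoissonProcess (fun ω => pointMeasure (X · ω)) Λ P)
    (ho : ∀ᵐ ω ∂P, Monotone fun n => ‖X n ω‖) (hM : ∀ n, Measurable (M n))
    (hMlaw : ∀ n, HasLaw (M n) ν P) (hMi : iIndepFun M P)
    (hXM : IndepFun (fun ω n => X n ω) (fun ω n => M n ω) P) (j : ℕ)
    {g : Plane × 𝓜 → ℝ≥0∞} (hg : Measurable g) {A : Set ℝ} (hA : MeasurableSet A) :
    ∫⁻ ω in {ω | ‖X j ω‖ ∈ A}, expNeg (∑' i,
        (outside ‖X j ω‖).indicator (fun x => g (x, M i ω)) (X i ω)) ∂P =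
      ∫⁻ ω in {ω | ‖X j ω‖ ∈ A}, expNeg (∫⁻ x in outside ‖X j ω‖,
        (1 - ∫⁻ m, expNeg (g (x, m)) ∂ν) ∂Λ) ∂P := by
  set w : Plane → ℝ≥0∞ := fun x => negLog (∫⁻ m, expNeg (g (x, m)) ∂ν) with hw
  have hwm : Measurable w :=
    measurable_negLog.comp (measurable_expNeg.comp hg).lintegral_prod_right'
  have hu1 : ∀ x, ∫⁻ m, expNeg (g (x, m)) ∂ν ≤ 1 := fun x =>
    (lintegral_mono fun m => expNeg_le_one _).trans (by simp)
  have hlim : ∀ f : ℕ → Ω → ℝ≥0∞, (∀ i, Measurable (f i)) →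
      Tendsto (fun n => ∫⁻ ω in {ω | ‖X j ω‖ ∈ A}, expNeg (∑ i ∈ Finset.range n, f i ω) ∂P) atTop
        (𝓝 (∫⁻ ω in {ω | ‖X j ω‖ ∈ A}, expNeg (∑' i, f i ω) ∂P)) := by
    intro f hf
    refine tendsto_lintegral_of_dominated_convergence (fun _ => 1) (fun m => ?_)
      (fun n => Eventually.of_forall fun ω => expNeg_le_one _) (by simp)
      (Eventually.of_forall fun ω => ?_)
    · exact measurable_expNeg.comp (Finset.measurable_sum _ fun i _ => hf i)
    · exact (continuous_expNeg.tendsto _).comp (ENNReal.tendsto_nat_tsum _)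
  have h1 := hlim (fun i ω => (outside ‖X j ω‖).indicator (fun x => g (x, M i ω)) (X i ω))
    fun i => measurable_indicator_outside (hX j).norm (hX i) (f := fun ω x => g (x, M i ω))
      (hg.comp ((hX i).prodMk (hM i)))
  have h2 := hlim (fun i ω => (outside ‖X j ω‖).indicator w (X i ω))
    fun i => measurable_indicator_outside (hX j).norm (hX i) (f := fun _ => w) (hwm.comp (hX i))
  simp only [lintegral_expNeg_sum_marks hX hM hMlaw hMi hXM j hg hA] at h1
  rw [tendsto_nhds_unique h1 h2]
  have h3 := lintegral_expNeg_outside hX hN ho j hwm hA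
  simp only [hw, expNeg_negLog (hu1 _)] at h3
  rw [← h3]
  refine lintegral_congr fun ω => ?_
  rw [← lintegral_indicator (measurableSet_outside _),
    lintegral_pointMeasure _ (hwm.indicator (measurableSet_outside _))]

end

/-! ### The law of the distance of the nearest points -/

section

/-- The probability that a Poisson variable of mean `y` is at most `j`. -/
def poissonCDF (j : ℕ) (y : ℝ) : ℝ :=
  ∑ i ∈ Finset.range (j + 1), Real.exp (-y) * y ^ i / (i.factorial : ℝ)

lemma hasDerivAt_poissonCDF (j : ℕ) (y : ℝ) :
    HasDerivAt (poissonCDF j) (-(Real.exp (-y) * y ^ j / (j.factorial : ℝ))) y := by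
  have hexp : HasDerivAt (fun y : ℝ => Real.exp (-y)) (-Real.exp (-y)) y := by
    simpa using (hasDerivAt_neg y).exp
  induction j with
  | zero =>
    have : poissonCDF 0 = fun y => Real.exp (-y) := by ext y; simp [poissonCDF]
    rw [this]
    simpa using hexp
  | succ j ih =>
    have h1 : poissonCDF (j + 1) = fun y => poissonCDF j y +
        Real.exp (-y) * y ^ (j + 1) / ((j + 1).factorial : ℝ) := by
      ext y; rw [poissonCDF, Finset.sum_range_succ]; rfl
    rw [h1]
    refine (ih.add ((hexp.mul (hasDerivAt_pow (j + 1) y)).div_const _)).congr_deriv ?_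
    have : (j.factorial : ℝ) ≠ 0 := by positivity
    rw [Nat.factorial_succ]
    push_cast
    field_simp
    ring

lemma poissonMeasure_Ici (j : ℕ) (r : NNReal) :
    poissonMeasure r (Ici (j + 1)) = ENNReal.ofReal (1 - poissonCDF j r) := by
  have h1 : (Ici (j + 1) : Set ℕ) = (↑(Finset.range (j + 1)) : Set ℕ)ᶜ := by
    ext i; simp
  have h2 : poissonMeasure r (↑(Finset.range (j + 1)) : Set ℕ) =
      ENNReal.ofReal (poissonCDF j r) := by
    rw [← sum_measure_singleton, poissonCDF, ENNReal.ofReal_sum_of_nonneg fun i _ => by positivity]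
    exact Finset.sum_congr rfl fun i _ => poissonMeasure_singleton r i
  rw [h1, prob_compl_eq_one_sub (Finset.measurableSet _), h2, ENNReal.ofReal_sub,
    ENNReal.ofReal_one]
  exact Finset.sum_nonneg fun i _ => by positivity

lemma volume_smul_closedBall {lam c : ℝ} (hlam : 0 ≤ lam) (hc : 0 ≤ c) :
    (ENNReal.ofReal lam • (volume : Measure Plane)) (Metric.closedBall 0 c) =
      ENNReal.ofReal (lam * Real.pi * c ^ 2) := by
  rw [Measure.smul_apply, EuclideanSpace.volume_closedBall_fin_two, smul_eq_mul,
    ← ENNReal.ofReal_pow hc, ← ENNReal.ofReal_mul (by positivity), ← ENNReal.ofReal_mul hlam]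
  congr 1; ring

lemma continuous_distDensity (k : ℕ) (lam : ℝ) : Continuous (distDensity k lam) := by
  unfold distDensity; fun_prop

lemma distDensity_pos {k : ℕ} {lam r : ℝ} (hlam : 0 < lam) (hr : 0 < r) :
    0 < distDensity k lam r := by
  unfold distDensity; positivity

lemma distDensity_nonneg {k : ℕ} {lam r : ℝ} (hlam : 0 < lam) (hr : 0 ≤ r) :
    0 ≤ distDensity k lam r := by
  unfold distDensity; positivity

lemma integral_distDensity (j : ℕ) (lam c : ℝ) :
    ∫ r in (0 : ℝ)..c, distDensity (j + 1) lam r = 1 - poissonCDF j (lam * Real.pi * c ^ 2) := by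
  have hd : ∀ r : ℝ, HasDerivAt (fun r => -poissonCDF j (lam * Real.pi * r ^ 2))
      (distDensity (j + 1) lam r) r := by
    intro r
    have h1 : HasDerivAt (fun r : ℝ => lam * Real.pi * r ^ 2) (lam * Real.pi * (2 * r)) r := by
      simpa using (hasDerivAt_pow 2 r).const_mul (lam * Real.pi)
    refine ((hasDerivAt_poissonCDF j _).comp r h1).neg.congr_deriv ?_
    unfold distDensity
    rw [Nat.add_sub_cancel, show 2 * (j + 1) - 1 = 2 * j + 1 by omega,
      show -lam * Real.pi * r ^ 2 = -(lam * Real.pi * r ^ 2) by ring]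
    ring
  rw [intervalIntegral.integral_eq_sub_of_hasDerivAt (fun r _ => hd r)
    ((continuous_distDensity _ _).intervalIntegrable _ _)]
  have h0 : poissonCDF j (lam * Real.pi * 0 ^ 2) = 1 := by
    simp [poissonCDF, Finset.sum_range_succ']
  rw [h0]; ring

/-- The law of the distance of the `j`-th nearest point (counted from `0`) of a homogeneous Poisson
process: this distance is at most `c` iff the disc of radius `c` holds at least `j + 1` points. -/
theorem hasLaw_norm_of_poisson {Ω : Type*} [MeasurableSpace Ω] {P : Measure Ω}
    [IsProbabilityMeasure P] {X : ℕ → Ω → Plane} {lam : ℝ} (hlam : 0 < lam)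
    (hX : ∀ n, Measurable (X n))
    (hN : IsPoissonProcess (fun ω => pointMeasure (X · ω)) (ENNReal.ofReal lam • volume) P)
    (ho : ∀ᵐ ω ∂P, Monotone fun n => ‖X n ω‖) (j : ℕ) :
    HasLaw (fun ω => ‖X j ω‖) ((volume.restrict (Ioi 0)).withDensity fun r =>
      ENNReal.ofReal (distDensity (j + 1) lam r)) P := by
  have hR : Measurable fun ω => ‖X j ω‖ := (hX j).norm
  have : IsProbabilityMeasure (P.map fun ω => ‖X j ω‖) :=
    Measure.isProbabilityMeasure_map hR.aemeasurable
  refine ⟨hR.aemeasurable, Measure.ext_of_Iic _ _ fun c => ?_⟩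
  rw [Measure.map_apply hR measurableSet_Iic, withDensity_apply _ measurableSet_Iic,
    Measure.restrict_restrict measurableSet_Iic, Iic_inter_Ioi]
  rcases lt_or_ge c 0 with hc | hc
  · rw [Ioc_eq_empty (by linarith)]
    have : (fun ω => ‖X j ω‖) ⁻¹' Iic c = ∅ := by
      ext ω
      simpa using hc.trans_le (norm_nonneg _)
    simp [this]
  · have hae : (fun ω => ‖X j ω‖) ⁻¹' Iic c =ᵐ[P] {ω | pointMeasure (X · ω)
        (Metric.closedBall 0 c) ∈ Ici ((j + 1 : ℕ) : ℝ≥0∞)} := by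
      filter_upwards [ho] with ω hω
      exact propext (norm_le_iff_le_pointMeasure hω j c)
    have hΛ := volume_smul_closedBall hlam.le hc
    have hlaw := (hN.hasLaw_count (Metric.closedBall 0 c) Metric.isClosed_closedBall.measurableSet
      (by rw [hΛ]; exact ofReal_ne_top)).measure_eq (p := (· ∈ Ici ((j + 1 : ℕ) : ℝ≥0∞)))
      measurableSet_Ici
    rw [measure_congr hae, hlaw, hΛ]
    erw [Measure.map_apply (measurable_of_countable _) measurableSet_Ici]
    have hpre : (Nat.cast : ℕ → ℝ≥0∞) ⁻¹' Ici ((j + 1 : ℕ) : ℝ≥0∞) = Ici (j + 1) := by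
      ext i
      simp only [mem_preimage, mem_Ici, Nat.cast_le]
    rw [hpre, poissonMeasure_Ici, ← ofReal_integral_eq_lintegral_ofReal,
      ← intervalIntegral.integral_of_le hc, integral_distDensity]
    · rw [ENNReal.coe_toNNReal_eq_toReal, ENNReal.toReal_ofReal (by positivity)]
    · exact ((continuous_distDensity _ _).intervalIntegrable 0 c).1
    · filter_upwards [ae_restrict_mem measurableSet_Ioc] with r hr
      exact distDensity_nonneg hlam hr.1.le

end

/-! ### The integrals in the Laplace exponent -/

section

/-- The inner integral `∫ π b e^{-bπq} / (1 + c q^{αε/2} v^{-α}) dq` over `q > 0`: the Laplace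
transform, at `c μ`, of the power received from one interferer at distance `v`. -/
def markLaplace (b α ε c v : ℝ) : ℝ :=
  ∫ q in Ioi (0 : ℝ), Real.pi * b * Real.exp (-b * Real.pi * q) /
    (1 + c * q ^ (α * ε / 2) * v ^ (-α))

/-- The integral of `(1 - markLaplace) v` over `v > r`. -/
def laplaceExponent (b α ε c r : ℝ) : ℝ :=
  ∫ v in Ioi r, (1 - markLaplace b α ε c v) * v

/-- The moment `E[R_x^{2 s}]` of the Rayleigh law, written as an integral over `q = R_x²`. -/
def markMoment (b s : ℝ) : ℝ :=
  ∫ q in Ioi (0 : ℝ), q ^ s * (Real.pi * b * Real.exp (-b * Real.pi * q))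

section

variable {b α ε : ℝ}

lemma integrableOn_exp_weight (hb : 0 < b) :
    IntegrableOn (fun q => Real.pi * b * Real.exp (-b * Real.pi * q)) (Ioi 0) := by
  have := (integrableOn_exp_mul_Ioi (a := -b * Real.pi)
    (by have := mul_pos hb Real.pi_pos; linarith) 0).const_mul (Real.pi * b)
  exact this

lemma integral_exp_weight (hb : 0 < b) :
    ∫ q in Ioi (0 : ℝ), Real.pi * b * Real.exp (-b * Real.pi * q) = 1 := by
  have hbp := mul_pos hb Real.pi_pos
  rw [integral_const_mul, integral_exp_mul_Ioi (by linarith)]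
  have := Real.pi_pos.ne'
  have := hb.ne'
  simp
  field_simp

lemma integrableOn_rpow_mul_exp_weight (hb : 0 < b) {s : ℝ} (hs : 0 ≤ s) :
    IntegrableOn (fun q => q ^ s * (Real.pi * b * Real.exp (-b * Real.pi * q))) (Ioi 0) := by
  have h := (integrableOn_rpow_mul_exp_neg_mul_rpow (p := 1) (s := s) (b := b * Real.pi)
    (by linarith) one_pos (mul_pos hb Real.pi_pos)).const_mul (Real.pi * b)
  refine IntegrableOn.congr_fun h (fun q _ => ?_) measurableSet_Ioi
  simp only [Real.rpow_one]
  rw [show -(b * Real.pi) * q = -b * Real.pi * q by ring]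
  ring

lemma measurable_markIntegrand (b α ε c : ℝ) : Measurable fun x : ℝ × ℝ =>
    Real.pi * b * Real.exp (-b * Real.pi * x.2) / (1 + c * x.2 ^ (α * ε / 2) * x.1 ^ (-α)) := by
  fun_prop

lemma markIntegrand_bound (hb : 0 < b) {c v q : ℝ} (hc : 0 ≤ c) (hv : 0 ≤ v) (hq : 0 ≤ q) :
    ‖Real.pi * b * Real.exp (-b * Real.pi * q) / (1 + c * q ^ (α * ε / 2) * v ^ (-α))‖ ≤
      Real.pi * b * Real.exp (-b * Real.pi * q) := by
  have h1 : 0 ≤ c * q ^ (α * ε / 2) * v ^ (-α) := by positivity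
  rw [Real.norm_of_nonneg (by positivity)]
  exact div_le_self (by positivity) (by linarith)

lemma integrableOn_markIntegrand (hb : 0 < b) {c v : ℝ} (hc : 0 ≤ c) (hv : 0 ≤ v) :
    IntegrableOn (fun q => Real.pi * b * Real.exp (-b * Real.pi * q) /
      (1 + c * q ^ (α * ε / 2) * v ^ (-α))) (Ioi 0) := by
  refine (integrableOn_exp_weight hb).mono'
    ((measurable_markIntegrand b α ε c).comp measurable_prodMk_left).aestronglyMeasurable ?_
  filter_upwards [ae_restrict_mem measurableSet_Ioi] with q hq
  exact markIntegrand_bound hb hc hv hq.le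

lemma markLaplace_nonneg (hb : 0 < b) {c v : ℝ} (hc : 0 ≤ c) (hv : 0 ≤ v) :
    0 ≤ markLaplace b α ε c v := by
  refine setIntegral_nonneg measurableSet_Ioi fun q hq => ?_
  have hq : (0 : ℝ) < q := hq
  positivity

lemma markLaplace_le_one (hb : 0 < b) {c v : ℝ} (hc : 0 ≤ c) (hv : 0 ≤ v) :
    markLaplace b α ε c v ≤ 1 := by
  rw [← integral_exp_weight hb]
  refine setIntegral_mono_on (integrableOn_markIntegrand hb hc hv) (integrableOn_exp_weight hb)
    measurableSet_Ioi fun q hq => ?_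
  exact (le_abs_self _).trans (markIntegrand_bound hb hc hv hq.le)

lemma markLaplace_zero (hb : 0 < b) (v : ℝ) : markLaplace b α ε 0 v = 1 := by
  simpa [markLaplace] using integral_exp_weight hb

/-- From `1 - 1 / (1 + y) ≤ y`. It makes the outer integral converge, as `α > 2`. -/
lemma one_sub_markLaplace_le (hb : 0 < b) (hs : 0 ≤ α * ε) {c v : ℝ} (hc : 0 ≤ c) (hv : 0 ≤ v) :
    1 - markLaplace b α ε c v ≤ c * v ^ (-α) *
      markMoment b (α * ε / 2) := by
  rw [← integral_exp_weight hb, markLaplace, markMoment, ← integral_const_mul,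
    ← integral_sub (integrableOn_exp_weight hb) (integrableOn_markIntegrand hb hc hv)]
  refine setIntegral_mono_on ((integrableOn_exp_weight hb).sub
    (integrableOn_markIntegrand hb hc hv))
    ((integrableOn_rpow_mul_exp_weight hb (by linarith)).const_mul _) measurableSet_Ioi
    fun q hq => ?_
  have hq : (0 : ℝ) < q := hq
  set E := Real.pi * b * Real.exp (-b * Real.pi * q)
  have hE : 0 ≤ E := by positivity
  set y := c * q ^ (α * ε / 2) * v ^ (-α) with hy
  have hy0 : 0 ≤ y := by positivity
  have : E - E / (1 + y) = E * y / (1 + y) := by field_simp; ring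
  rw [this]
  refine (div_le_self (by positivity) (by linarith)).trans (le_of_eq ?_)
  rw [hy]; ring

lemma measurable_markLaplace (b α ε c : ℝ) : Measurable (markLaplace b α ε c) :=
  ((measurable_markIntegrand b α ε c).stronglyMeasurable.integral_prod_right
    (ν := volume.restrict (Ioi 0))).measurable

lemma continuous_markLaplace (hb : 0 < b) {v : ℝ} (hv : 0 ≤ v) :
    Continuous fun c : NNReal => markLaplace b α ε c v := by
  refine continuous_of_dominated (fun c => ?_) (fun c => ?_) (integrableOn_exp_weight hb) ?_
  · exact ((measurable_markIntegrand b α ε c).comp measurable_prodMk_left).aestronglyMeasurable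
  · filter_upwards [ae_restrict_mem measurableSet_Ioi] with q hq
    exact markIntegrand_bound hb c.2 hv hq.le
  · filter_upwards [ae_restrict_mem measurableSet_Ioi] with q hq
    have hq : (0 : ℝ) < q := hq
    refine continuous_const.div (by fun_prop) fun c => ?_
    positivity

lemma exponentIntegrand_bound (hb : 0 < b) (hs : 0 ≤ α * ε) {c v : ℝ} (hc : 0 ≤ c) (hv : 0 < v) :
    ‖(1 - markLaplace b α ε c v) * v‖ ≤ c *
      (markMoment b (α * ε / 2) *
        v ^ (1 - α)) := by
  have h1 := one_sub_markLaplace_le hb hs hc hv.le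
  have h2 := markLaplace_le_one (α := α) (ε := ε) hb hc hv.le
  rw [Real.norm_of_nonneg (mul_nonneg (by linarith) hv.le)]
  refine (mul_le_mul_of_nonneg_right h1 hv.le).trans (le_of_eq ?_)
  rw [show 1 - α = -α + 1 by ring, Real.rpow_add_one hv.ne']
  ring

lemma measurable_exponentIntegrand (b α ε c : ℝ) :
    Measurable fun v => (1 - markLaplace b α ε c v) * v :=
  (measurable_const.sub (measurable_markLaplace b α ε c)).mul measurable_id

lemma integrableOn_exponentIntegrand (hb : 0 < b) (hα : 2 < α) (hs : 0 ≤ α * ε) {c r : ℝ}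
    (hc : 0 ≤ c) (hr : 0 < r) :
    IntegrableOn (fun v => (1 - markLaplace b α ε c v) * v) (Ioi r) := by
  refine (((integrableOn_Ioi_rpow_of_lt (by linarith : 1 - α < -1) hr).const_mul
    (markMoment b (α * ε / 2))).const_mul c).mono'
    (measurable_exponentIntegrand b α ε c).aestronglyMeasurable ?_
  filter_upwards [ae_restrict_mem measurableSet_Ioi] with v hv
  exact exponentIntegrand_bound hb hs hc (hr.trans hv)

lemma laplaceExponent_nonneg (hb : 0 < b) {c r : ℝ} (hc : 0 ≤ c) (hr : 0 ≤ r) :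
    0 ≤ laplaceExponent b α ε c r := by
  refine setIntegral_nonneg measurableSet_Ioi fun v hv => ?_
  have hv : 0 ≤ v := hr.trans hv.le
  exact mul_nonneg (sub_nonneg.2 (markLaplace_le_one hb hc hv)) hv

lemma continuous_laplaceExponent (hb : 0 < b) (hα : 2 < α) (hs : 0 ≤ α * ε) {r : ℝ} (hr : 0 < r) :
    Continuous fun c : NNReal => laplaceExponent b α ε c r := by
  rw [continuous_iff_continuousAt]
  intro c₀
  refine continuousAt_of_dominated (Eventually.of_forall fun c =>
      (measurable_exponentIntegrand b α ε c).aestronglyMeasurable) ?_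
    (((integrableOn_Ioi_rpow_of_lt (by linarith : 1 - α < -1) hr).const_mul
      (markMoment b (α * ε / 2))).const_mul
      ((c₀ : ℝ) + 1)) ?_
  · filter_upwards [Iic_mem_nhds (lt_add_one c₀)] with c hc
    filter_upwards [ae_restrict_mem measurableSet_Ioi] with v hv
    have hv0 : 0 < v := hr.trans hv
    refine (exponentIntegrand_bound hb hs c.2 hv0).trans ?_
    refine mul_le_mul_of_nonneg_right (by exact_mod_cast hc) (mul_nonneg ?_ (by positivity))
    refine setIntegral_nonneg measurableSet_Ioi fun q hq => ?_
    have hq : (0 : ℝ) < q := hq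
    positivity
  · filter_upwards [ae_restrict_mem measurableSet_Ioi] with v hv
    have hv0 : 0 < v := hr.trans hv
    exact ((continuous_const.sub (continuous_markLaplace hb hv0.le)).mul
      continuous_const).continuousAt

lemma measurable_laplaceExponent (b α ε c : ℝ) : Measurable (laplaceExponent b α ε c) := by
  have h : laplaceExponent b α ε c =
      fun r => ∫ v, (Ioi r).indicator (fun v => (1 - markLaplace b α ε c v) * v) v := by
    ext r
    rw [integral_indicator measurableSet_Ioi]; rfl
  have hm : Measurable fun x : ℝ × ℝ =>
      (Ioi x.1).indicator (fun v => (1 - markLaplace b α ε c v) * v) x.2 :=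
    ((measurable_exponentIntegrand b α ε c).comp measurable_snd).indicator
      (measurableSet_lt measurable_fst measurable_snd)
  rw [h]
  exact hm.stronglyMeasurable.integral_prod_right.measurable

lemma laplaceExponent_zero (hb : 0 < b) (r : ℝ) : laplaceExponent b α ε 0 r = 0 := by
  simp [laplaceExponent, markLaplace_zero hb]

end

end

/-! ### The mean over the mark of one user -/

section

/-- The law of the mark (thinning variable, distance to the own base station, fading). -/
abbrev markLaw (b : ℝ) (p : unitInterval) (μ : ℝ) : Measure (Bool × ℝ × ℝ) :=
  (bernoulliMeasure true false p).prod ((rayleighMeasure b).prod (expMeasure μ))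

/-- The power received at the origin from a user, given by its location and its mark, and `0` if it
is not retained. A negative real value, which has probability `0`, is replaced by `0`. -/
def receivedPower (α ε : ℝ) (q : Plane × (Bool × ℝ × ℝ)) : ℝ≥0∞ :=
  if q.2.1 = true then ENNReal.ofReal (q.2.2.2 * q.2.2.1 ^ (α * ε) * ‖q.1‖ ^ (-α)) else 0

lemma measurable_receivedPower (α ε : ℝ) : Measurable (receivedPower α ε) := by
  have h : Measurable fun q : Plane × (Bool × ℝ × ℝ) => q.2.1 :=
    measurable_fst.comp measurable_snd
  refine Measurable.ite (h (measurableSet_singleton true)) ?_ measurable_const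
  refine ENNReal.measurable_ofReal.comp ?_
  have h1 : Measurable fun q : Plane × (Bool × ℝ × ℝ) => q.2.2.1 := by fun_prop
  have h2 : Measurable fun q : Plane × (Bool × ℝ × ℝ) => q.2.2.2 := by fun_prop
  exact (h2.mul (h1.pow_const _)).mul (measurable_fst.norm.pow_const _)

lemma lintegral_expNeg_expMeasure {μ s : ℝ} (hμ : 0 < μ) (hs : 0 ≤ s) :
    ∫⁻ y, expNeg (ENNReal.ofReal (s * y)) ∂(expMeasure μ) = ENNReal.ofReal (μ / (μ + s)) := by
  have hm : Measurable fun y : ℝ => expNeg (ENNReal.ofReal (s * y)) :=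
    measurable_expNeg.comp (ENNReal.measurable_ofReal.comp (measurable_id.const_mul s))
  have h0 : expMeasure μ = volume.withDensity (exponentialPDF μ) := rfl
  have hpdf : Measurable (exponentialPDF μ) := (measurable_exponentialPDFReal μ).ennreal_ofReal
  rw [h0, lintegral_withDensity_eq_lintegral_mul _ hpdf hm]
  have h1 : (exponentialPDF μ * fun y : ℝ => expNeg (ENNReal.ofReal (s * y))) =
      (Ici (0 : ℝ)).indicator fun y => ENNReal.ofReal (μ * Real.exp (-(μ + s) * y)) := by
    ext y
    by_cases hy : 0 ≤ y
    · rw [indicator_of_mem (show y ∈ Ici (0 : ℝ) from hy), Pi.mul_apply, exponentialPDF_eq,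
        if_pos hy, expNeg_ofReal (mul_nonneg hs hy), ← ENNReal.ofReal_mul (by positivity),
        mul_assoc, ← Real.exp_add]
      congr 3; ring
    · rw [indicator_of_notMem (show y ∉ Ici (0 : ℝ) from hy), Pi.mul_apply, exponentialPDF_eq,
        if_neg hy]
      simp
  have hneg : -(μ + s) < 0 := by linarith
  rw [h1, lintegral_indicator measurableSet_Ici, setLIntegral_congr Ioi_ae_eq_Ici.symm,
    ← ofReal_integral_eq_lintegral_ofReal ((integrableOn_exp_mul_Ioi hneg 0).const_mul μ)
      (Eventually.of_forall fun y => by positivity), integral_const_mul, integral_exp_mul_Ioi hneg]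
  congr 1
  have : μ + s ≠ 0 := by linarith
  simp only [mul_zero, Real.exp_zero]
  field_simp

lemma ae_rayleighMeasure_pos (b : ℝ) : ∀ᵐ ρ ∂(rayleighMeasure b), 0 < ρ := by
  refine (withDensity_absolutelyContinuous _ _).ae_le ?_
  rw [← Measure.restrict_congr_set Ioi_ae_eq_Ici]
  exact ae_restrict_mem measurableSet_Ioi

/-- The substitution `q = ρ²` turns the Rayleigh law into an exponential one. -/
lemma lintegral_rayleigh {b α ε c v : ℝ} (hb : 0 < b) (hc : 0 ≤ c) (hv : 0 ≤ v) :
    ∫⁻ ρ, ENNReal.ofReal (1 / (1 + c * ρ ^ (α * ε) * v ^ (-α))) ∂(rayleighMeasure b) =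
      ENNReal.ofReal (markLaplace b α ε c v) := by
  have hm : Measurable fun ρ : ℝ => ENNReal.ofReal (1 / (1 + c * ρ ^ (α * ε) * v ^ (-α))) := by
    fun_prop
  set F : ℝ → ℝ := fun q => Real.pi * b * Real.exp (-b * Real.pi * q) /
    (1 + c * q ^ (α * ε / 2) * v ^ (-α)) with hF
  have hint := (integrableOn_Ioi_comp_rpow_iff (f := F) (two_ne_zero' ℝ)).2
    (integrableOn_markIntegrand hb hc hv)
  rw [rayleighMeasure, lintegral_withDensity_eq_lintegral_mul _ (by fun_prop) hm,
    setLIntegral_congr Ioi_ae_eq_Ici.symm, markLaplace,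
    ← integral_comp_rpow_Ioi F (two_ne_zero' ℝ), ofReal_integral_eq_lintegral_ofReal hint]
  · refine setLIntegral_congr_fun measurableSet_Ioi fun ρ hρ => ?_
    have hρ : (0 : ℝ) < ρ := hρ
    simp only [Pi.mul_apply, hF, smul_eq_mul]
    rw [← ENNReal.ofReal_mul (by positivity)]
    congr 1
    rw [← Real.rpow_mul hρ.le, show (2 : ℝ) * (α * ε / 2) = α * ε by ring,
      show (2 : ℝ) - 1 = 1 by norm_num, Real.rpow_one, abs_of_pos two_pos,
      show ρ ^ (2 : ℝ) = ρ ^ 2 from Real.rpow_two ρ]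
    ring
  · filter_upwards [ae_restrict_mem measurableSet_Ioi] with ρ hρ
    have hρ : (0 : ℝ) < ρ := hρ
    simp only [hF, Pi.zero_apply, smul_eq_mul]
    positivity

lemma isProbabilityMeasure_rayleighMeasure {b : ℝ} (hb : 0 < b) :
    IsProbabilityMeasure (rayleighMeasure b) := by
  have := lintegral_rayleigh (α := 0) (ε := 0) hb le_rfl (le_refl (0 : ℝ))
  rw [markLaplace_zero hb] at this
  exact ⟨by simpa using this⟩

lemma lintegral_bernoulliMeasure (p : unitInterval) (f : Bool → ℝ≥0∞) :
    ∫⁻ β, f β ∂(bernoulliMeasure true false p) =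
      ENNReal.ofReal p * f true + ENNReal.ofReal (1 - p) * f false := by
  have h (q : unitInterval) : ((unitInterval.toNNReal q : NNReal) : ℝ≥0∞) = ENNReal.ofReal q := by
    rw [← ENNReal.ofReal_coe_nnreal]; rfl
  rw [bernoulliMeasure_def, lintegral_add_measure, lintegral_smul_measure, lintegral_smul_measure,
    lintegral_dirac, lintegral_dirac, ENNReal.smul_def, ENNReal.smul_def, h, h, smul_eq_mul,
    smul_eq_mul, unitInterval.coe_symm_eq]

/-- The Laplace transform of the power received from one user, thinning included. -/
lemma lintegral_expNeg_receivedPower {b α ε c μ : ℝ} (p : unitInterval) (hb : 0 < b) (hμ : 0 < μ)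
    (hc : 0 ≤ c) (x : Plane) :
    1 - ∫⁻ m, expNeg (ENNReal.ofReal (c * μ) * receivedPower α ε (x, m)) ∂(markLaw b p μ) =
      ENNReal.ofReal (p * (1 - markLaplace b α ε c ‖x‖)) := by
  have := isProbabilityMeasure_expMeasure hμ
  have := isProbabilityMeasure_rayleighMeasure hb
  have hv := norm_nonneg x
  have key : ∫⁻ m, expNeg (ENNReal.ofReal (c * μ) *
      ENNReal.ofReal (m.2 * m.1 ^ (α * ε) * ‖x‖ ^ (-α)))
        ∂((rayleighMeasure b).prod (expMeasure μ)) =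
      ENNReal.ofReal (markLaplace b α ε c ‖x‖) := by
    rw [lintegral_prod _ (by
      refine (measurable_expNeg.comp (Measurable.const_mul (ENNReal.measurable_ofReal.comp ?_)
        _)).aemeasurable
      exact (measurable_snd.mul (measurable_fst.pow_const _)).mul_const _),
      ← lintegral_rayleigh hb hc hv]
    refine lintegral_congr_ae ?_
    filter_upwards [ae_rayleighMeasure_pos b] with ρ hρ
    have hs : 0 ≤ c * μ * (ρ ^ (α * ε) * ‖x‖ ^ (-α)) := by positivity
    have h1 := lintegral_expNeg_expMeasure hμ hs
    have h2 : ∀ y : ℝ, ENNReal.ofReal (c * μ) * ENNReal.ofReal (y * ρ ^ (α * ε) * ‖x‖ ^ (-α)) =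
        ENNReal.ofReal (c * μ * (ρ ^ (α * ε) * ‖x‖ ^ (-α)) * y) := by
      intro y
      rw [← ENNReal.ofReal_mul (by positivity)]
      congr 1; ring
    simp only [h2]
    rw [h1]
    congr 1
    have : 0 ≤ c * ρ ^ (α * ε) * ‖x‖ ^ (-α) := by positivity
    have h3 : μ + c * μ * (ρ ^ (α * ε) * ‖x‖ ^ (-α)) = μ * (1 + c * ρ ^ (α * ε) * ‖x‖ ^ (-α)) := by
      ring
    rw [h3]
    field_simp
  have hm : Measurable fun m : Bool × ℝ × ℝ =>
      expNeg (ENNReal.ofReal (c * μ) * receivedPower α ε (x, m)) :=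
    measurable_expNeg.comp
      (((measurable_receivedPower α ε).comp measurable_prodMk_left).const_mul _)
  rw [markLaw, lintegral_prod _ hm.aemeasurable, lintegral_bernoulliMeasure]
  simp only [receivedPower, if_true, Bool.false_eq_true, if_false, mul_zero, expNeg_zero]
  rw [key, lintegral_one, measure_univ, mul_one, ← ENNReal.ofReal_mul p.2.1, ← ENNReal.ofReal_add
    (mul_nonneg p.2.1 (markLaplace_nonneg hb hc hv)) (sub_nonneg.2 p.2.2), ← ENNReal.ofReal_one,
    ← ENNReal.ofReal_sub _ (add_nonneg (mul_nonneg p.2.1 (markLaplace_nonneg hb hc hv))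
      (sub_nonneg.2 p.2.2))]
  congr 1; ring

/-- The mean number of interferers beyond distance `r`, weighted by their Laplace transforms, in
polar coordinates. -/
lemma lintegral_outside_markLaplace {b α ε c lam r : ℝ} (p : unitInterval) (hb : 0 < b)
    (hα : 2 < α) (hs : 0 ≤ α * ε) (hlam : 0 ≤ lam) (hc : 0 ≤ c) (hr : 0 < r) :
    ∫⁻ x in outside r, ENNReal.ofReal (p * (1 - markLaplace b α ε c ‖x‖))
      ∂(ENNReal.ofReal lam • (volume : Measure Plane)) =
      ENNReal.ofReal (2 * Real.pi * p * lam * laplaceExponent b α ε c r) := by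
  set f : ℝ → ℝ := (Ioi r).indicator fun v => p * (1 - markLaplace b α ε c v) with hf
  have hf0 : ∀ v, 0 ≤ f v := fun v => indicator_nonneg (fun v (hv : r < v) =>
    mul_nonneg p.2.1 (sub_nonneg.2 (markLaplace_le_one hb hc (hr.trans hv).le))) v
  have hdim : Module.finrank ℝ Plane - 1 = 1 := by simp
  have hfv : (fun v => v ^ (Module.finrank ℝ Plane - 1) • f v) =
      (Ioi r).indicator fun v => p * ((1 - markLaplace b α ε c v) * v) := by
    ext v
    rw [hdim, pow_one, smul_eq_mul, hf]
    by_cases hv : v ∈ Ioi r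
    · rw [indicator_of_mem hv, indicator_of_mem hv]; ring
    · rw [indicator_of_notMem hv, indicator_of_notMem hv, mul_zero]
  have hinter : Ioi (0 : ℝ) ∩ Ioi r = Ioi r := inter_eq_right.2 (Ioi_subset_Ioi hr.le)
  have hint : Integrable (fun x : Plane => f ‖x‖) := by
    rw [integrable_fun_norm_addHaar, hfv]
    exact (IntegrableOn.integrable_indicator
      ((integrableOn_exponentIntegrand hb hα hs hc hr).const_mul (p : ℝ))
      measurableSet_Ioi).integrableOn
  have h1 : ∫ x : Plane, f ‖x‖ = 2 * Real.pi * (p * laplaceExponent b α ε c r) := by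
    rw [integral_fun_norm_addHaar, hfv, setIntegral_indicator measurableSet_Ioi, hinter,
      integral_const_mul, measureReal_def, EuclideanSpace.volume_ball_fin_two]
    simp [laplaceExponent, ENNReal.toReal_ofReal Real.pi_pos.le]
    ring
  have h2 : ∀ x : Plane, (outside r).indicator
      (fun x => ENNReal.ofReal (p * (1 - markLaplace b α ε c ‖x‖))) x = ENNReal.ofReal (f ‖x‖) := by
    intro x
    by_cases hx : r < ‖x‖
    · rw [indicator_of_mem (show x ∈ outside r from hx), hf, indicator_of_mem (mem_Ioi.2 hx)]
    · rw [indicator_of_notMem (show x ∉ outside r from hx), hf,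
        indicator_of_notMem (show ‖x‖ ∉ Ioi r from hx), ENNReal.ofReal_zero]
  rw [← lintegral_indicator (measurableSet_outside r), lintegral_smul_measure,
    lintegral_congr h2, ← ofReal_integral_eq_lintegral_ofReal hint
      (Eventually.of_forall fun x => hf0 _), h1, smul_eq_mul, ← ENNReal.ofReal_mul hlam]
  congr 1; ring

end

/-! ### Finiteness and positivity of the interference -/

section

lemma expMeasure_Ioi {μ y : ℝ} (hμ : 0 < μ) (hy : 0 ≤ y) :
    expMeasure μ (Ioi y) = ENNReal.ofReal (Real.exp (-(μ * y))) := by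
  have := isProbabilityMeasure_expMeasure hμ
  have h1 : expMeasure μ (Iic y) = ENNReal.ofReal (1 - Real.exp (-(μ * y))) := by
    have := cdf_expMeasure_eq hμ y
    rw [if_pos hy, cdf_eq_real] at this
    rw [← this, ofReal_measureReal]
  have h2 : Real.exp (-(μ * y)) ≤ 1 :=
    Real.exp_le_one_iff.2 (neg_nonpos.2 (mul_nonneg hμ.le hy))
  rw [← compl_Iic, prob_compl_eq_one_sub measurableSet_Iic, h1, ← ENNReal.ofReal_one,
    ← ENNReal.ofReal_sub _ (by linarith)]
  congr 1; ring

lemma sigmaFinite_ofReal_smul (lam : ℝ) :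
    SigmaFinite (ENNReal.ofReal lam • (volume : Measure Plane)) :=
  inferInstanceAs (SigmaFinite (lam.toNNReal • (volume : Measure Plane)))

section Model

variable {Ω : Type*} [MeasurableSpace Ω] {P : Measure Ω} {lam : ℝ} {p : unitInterval} {μ : ℝ}
  {X : ℕ → Ω → Plane} {B : ℕ → Ω → Bool} {Rx G : ℕ → Ω → ℝ}

lemma IsModel.measurable_mark (h : IsModel P lam p μ X B Rx G) (n : ℕ) :
    Measurable fun ω => (B n ω, Rx n ω, G n ω) :=
  (h.measurable_B n).prodMk ((h.measurable_Rx n).prodMk (h.measurable_G n))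

lemma IsModel.hasLaw_G (h : IsModel P lam p μ X B Rx G) [IsProbabilityMeasure P]
    (hb : 0 < (p : ℝ) * lam) (hμ : 0 < μ) (n : ℕ) : HasLaw (G n) (expMeasure μ) P := by
  have := isProbabilityMeasure_expMeasure hμ
  have := isProbabilityMeasure_rayleighMeasure hb
  have hsnd : MeasurePreserving (fun m : Bool × ℝ × ℝ => m.2.2)
      (markLaw (p * lam) p μ) (expMeasure μ) := measurePreserving_snd.comp measurePreserving_snd
  exact hsnd.hasLaw.comp (h.hasLaw_mark n)

lemma IsModel.ae_mark_pos (h : IsModel P lam p μ X B Rx G) [IsProbabilityMeasure P]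
    (hb : 0 < (p : ℝ) * lam) (hμ : 0 < μ) : ∀ᵐ ω ∂P, ∀ n, 0 < Rx n ω ∧ 0 < G n ω := by
  have := isProbabilityMeasure_expMeasure hμ
  have := isProbabilityMeasure_rayleighMeasure hb
  rw [ae_all_iff]
  intro n
  have h1 : ∀ᵐ ω ∂P, 0 < Rx n ω := by
    have hq : ∀ᵐ m ∂(markLaw (p * lam) p μ), 0 < m.2.1 :=
      (Measure.quasiMeasurePreserving_fst.comp Measure.quasiMeasurePreserving_snd).ae
        (ae_rayleighMeasure_pos _)
    exact ((h.hasLaw_mark n).ae_iff (p := fun m => 0 < m.2.1)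
      (measurableSet_lt measurable_const (measurable_fst.comp measurable_snd)).mem).2 hq
  have h2 : ∀ᵐ ω ∂P, 0 < G n ω := by
    refine ((h.hasLaw_G hb hμ n).ae_iff (p := fun y => 0 < y)
      (measurableSet_lt measurable_const measurable_id).mem).2 ?_
    have := (prob_compl_eq_zero_iff measurableSet_Ioi).2
      (by simpa using expMeasure_Ioi hμ (le_refl (0 : ℝ)))
    exact this
  exact h1.and h2

/-- The interference as an element of `[0, ∞]`; the users beyond the `j`-th one, counted from `0`,
may interfere. -/
def totalPower (j : ℕ) (α ε : ℝ) (X : ℕ → Ω → Plane) (B : ℕ → Ω → Bool) (Rx G : ℕ → Ω → ℝ)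
    (ω : Ω) : ℝ≥0∞ :=
  ∑' n, (outside ‖X j ω‖).indicator
    (fun x => receivedPower α ε (x, (B n ω, Rx n ω, G n ω))) (X n ω)

lemma IsModel.measurable_totalPower (h : IsModel P lam p μ X B Rx G) (j : ℕ) (α ε : ℝ) :
    Measurable (totalPower j α ε X B Rx G) := by
  refine Measurable.tsum fun n => ?_
  exact measurable_indicator_outside (h.measurable_X j).norm (h.measurable_X n)
    (f := fun ω x => receivedPower α ε (x, (B n ω, Rx n ω, G n ω)))
    ((measurable_receivedPower α ε).comp ((h.measurable_X n).prodMk (h.measurable_mark n)))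

variable [IsProbabilityMeasure P]

lemma IsModel.hasLaw_norm (h : IsModel P lam p μ X B Rx G) (hlam : 0 < lam) (j : ℕ) :
    HasLaw (fun ω => ‖X j ω‖) ((volume.restrict (Ioi 0)).withDensity fun r =>
      ENNReal.ofReal (distDensity (j + 1) lam r)) P :=
  hasLaw_norm_of_poisson hlam h.measurable_X h.poisson h.ordered j

lemma IsModel.ae_norm_pos (h : IsModel P lam p μ X B Rx G) (hlam : 0 < lam) (j : ℕ) :
    ∀ᵐ ω ∂P, 0 < ‖X j ω‖ := by
  refine ((h.hasLaw_norm hlam j).ae_iff (p := fun r => 0 < r)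
    (measurableSet_lt measurable_const measurable_id).mem).2 ?_
  exact (withDensity_absolutelyContinuous _ _).ae_le (ae_restrict_mem measurableSet_Ioi)

/-- The Laplace transform of the interference on events determined by the serving distance. -/
lemma IsModel.setLIntegral_expNeg_totalPower (h : IsModel P lam p μ X B Rx G) (hlam : 0 < lam)
    (hp : 0 < (p : ℝ)) (hμ : 0 < μ) {α ε : ℝ} (hα : 2 < α) (hs : 0 ≤ α * ε) (j : ℕ) {c : ℝ}
    (hc : 0 ≤ c) {A : Set ℝ} (hA : MeasurableSet A) :
    ∫⁻ ω in {ω | ‖X j ω‖ ∈ A},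
        expNeg (ENNReal.ofReal (c * μ) * totalPower j α ε X B Rx G ω) ∂P =
      ∫⁻ ω in {ω | ‖X j ω‖ ∈ A}, ENNReal.ofReal (Real.exp
        (-(2 * Real.pi * p * lam * laplaceExponent (p * lam) α ε c ‖X j ω‖))) ∂P := by
  have hb : 0 < (p : ℝ) * lam := mul_pos hp hlam
  have hν : IsProbabilityMeasure (markLaw (p * lam) p μ) :=
    (h.hasLaw_mark 0).isProbabilityMeasure_iff.1 inferInstance
  have := sigmaFinite_ofReal_smul lam
  have key := lintegral_expNeg_tsum_marks h.measurable_X h.poisson h.ordered h.measurable_mark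
    h.hasLaw_mark h.iIndep_mark h.indep_mark j
    (g := fun q => ENNReal.ofReal (c * μ) * receivedPower α ε q)
    ((measurable_receivedPower α ε).const_mul _) hA
  have hL : ∀ ω, ENNReal.ofReal (c * μ) * totalPower j α ε X B Rx G ω =
      ∑' i, (outside ‖X j ω‖).indicator (fun x => ENNReal.ofReal (c * μ) *
        receivedPower α ε (x, (B i ω, Rx i ω, G i ω))) (X i ω) := by
    intro ω
    rw [totalPower, ← ENNReal.tsum_mul_left]
    refine tsum_congr fun i => ?_
    rw [← indicator_const_mul]
  simp only [hL]
  rw [key]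
  refine setLIntegral_congr_fun_ae (h.measurable_X j |>.norm hA) ?_
  filter_upwards [h.ae_norm_pos hlam j] with ω hω _
  simp only [lintegral_expNeg_receivedPower p hb hμ hc]
  rw [lintegral_outside_markLaplace p hb hα hs hlam.le hc hω, expNeg_ofReal]
  have := laplaceExponent_nonneg (α := α) (ε := ε) hb hc hω.le
  positivity

/-- The interference is finite: its Laplace transform tends to `1` at `0`. -/
lemma IsModel.ae_totalPower_ne_top (h : IsModel P lam p μ X B Rx G) (hlam : 0 < lam)
    (hp : 0 < (p : ℝ)) (hμ : 0 < μ) {α ε : ℝ} (hα : 2 < α) (hs : 0 ≤ α * ε) (j : ℕ) :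
    ∀ᵐ ω ∂P, totalPower j α ε X B Rx G ω ≠ ∞ := by
  have hb : 0 < (p : ℝ) * lam := mul_pos hp hlam
  have hE : MeasurableSet {ω | totalPower j α ε X B Rx G ω ≠ ∞} :=
    (h.measurable_totalPower j α ε) (measurableSet_singleton ∞).compl
  set c : ℕ → NNReal := fun n => 1 / ((n : NNReal) + 1) with hc
  have hc0 : ∀ n, 0 < c n := fun n => by positivity
  have hct : Tendsto c atTop (𝓝 0) := tendsto_one_div_add_atTop_nhds_zero_nat
  have hle : ∀ n, ∫⁻ ω, ENNReal.ofReal (Real.exp (-(2 * Real.pi * p * lam *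
      laplaceExponent (p * lam) α ε (c n) ‖X j ω‖))) ∂P ≤
      P {ω | totalPower j α ε X B Rx G ω ≠ ∞} := by
    intro n
    have := h.setLIntegral_expNeg_totalPower hlam hp hμ hα hs j (c n).2 MeasurableSet.univ
    simp only [mem_univ, ofPred_true, Measure.restrict_univ, NNReal.val_eq_coe] at this
    rw [← this, ← lintegral_indicator_one hE]
    refine lintegral_mono fun ω => ?_
    -- where the interference is infinite its transform vanishes, as `c n ≠ 0`
    by_cases hω : totalPower j α ε X B Rx G ω = ∞
    · rw [hω, ENNReal.mul_top, expNeg_top]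
      · exact zero_le
      · rw [Ne, ENNReal.ofReal_eq_zero, not_le]
        exact mul_pos (hc0 n) hμ
    · rw [indicator_of_mem (show ω ∈ {ω | totalPower j α ε X B Rx G ω ≠ ∞} from hω)]
      exact expNeg_le_one _
  have hlim : Tendsto (fun n => ∫⁻ ω, ENNReal.ofReal (Real.exp (-(2 * Real.pi * p * lam *
      laplaceExponent (p * lam) α ε (c n) ‖X j ω‖))) ∂P) atTop (𝓝 (∫⁻ _, 1 ∂P)) := by
    refine tendsto_lintegral_of_dominated_convergence' (fun _ => 1) (fun n => ?_) (fun n => ?_)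
      (by simp) ?_
    · exact (ENNReal.measurable_ofReal.comp (Real.measurable_exp.comp
        (((measurable_laplaceExponent _ α ε _).comp (h.measurable_X j).norm).const_mul
          _).neg)).aemeasurable
    · filter_upwards [h.ae_norm_pos hlam j] with ω hω
      have := laplaceExponent_nonneg (α := α) (ε := ε) hb (c n).2 hω.le
      rw [ENNReal.ofReal_le_one, Real.exp_le_one_iff, neg_nonpos]
      positivity
    · filter_upwards [h.ae_norm_pos hlam j] with ω hω
      have h1 := ((continuous_laplaceExponent hb hα hs hω).tendsto 0).comp hct
      rw [NNReal.coe_zero, laplaceExponent_zero hb] at h1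
      have h2 := (ENNReal.continuous_ofReal.tendsto _).comp ((Real.continuous_exp.tendsto _).comp
        ((h1.const_mul (2 * Real.pi * p * lam)).neg))
      simpa [Function.comp_def] using h2
  have h1 : 1 ≤ P {ω | totalPower j α ε X B Rx G ω ≠ ∞} := by
    have := le_of_tendsto' hlim hle
    simpa using this
  rw [ae_iff]
  have := (prob_compl_eq_zero_iff hE).2 (le_antisymm prob_le_one h1)
  exact this

lemma volume_smul_outside {lam : ℝ} (hlam : 0 < lam) (r : ℝ) :
    (ENNReal.ofReal lam • (volume : Measure Plane)) (outside r) = ∞ := by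
  have h1 : outside r = (Metric.closedBall 0 r)ᶜ := by
    ext x; simp [outside]
  have h2 : (volume : Measure Plane) (Metric.closedBall 0 r) ≠ ∞ :=
    (isCompact_closedBall 0 r).measure_lt_top.ne
  rw [h1, Measure.smul_apply, measure_compl Metric.isClosed_closedBall.measurableSet h2,
    measure_univ_of_isAddLeftInvariant, ENNReal.top_sub h2, smul_eq_mul, ENNReal.mul_top]
  simpa using hlam

/-- There is an interferer: give each retained user infinite power, and note that the expected
number of interferers is infinite. -/
lemma IsModel.ae_exists_interferer (h : IsModel P lam p μ X B Rx G) (hlam : 0 < lam)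
    (hp : 0 < (p : ℝ)) (hμ : 0 < μ) (j : ℕ) :
    ∀ᵐ ω ∂P, ∃ n, ‖X j ω‖ < ‖X n ω‖ ∧ B n ω = true := by
  have hb : 0 < (p : ℝ) * lam := mul_pos hp hlam
  have hν : IsProbabilityMeasure (markLaw (p * lam) p μ) :=
    (h.hasLaw_mark 0).isProbabilityMeasure_iff.1 inferInstance
  set g : Plane × (Bool × ℝ × ℝ) → ℝ≥0∞ := fun q => if q.2.1 = true then ∞ else 0 with hg
  have hgm : Measurable g := Measurable.ite ((measurable_fst.comp measurable_snd)
    (measurableSet_singleton true)) measurable_const measurable_const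
  have := sigmaFinite_ofReal_smul lam
  have key := lintegral_expNeg_tsum_marks h.measurable_X h.poisson h.ordered h.measurable_mark
    h.hasLaw_mark h.iIndep_mark h.indep_mark j hgm MeasurableSet.univ
  simp only [mem_univ, ofPred_true, Measure.restrict_univ] at key
  have hu : ∀ x, 1 - ∫⁻ m, expNeg (g (x, m)) ∂(markLaw (p * lam) p μ) = ENNReal.ofReal p := by
    intro x
    have := isProbabilityMeasure_expMeasure hμ
    have := isProbabilityMeasure_rayleighMeasure hb
    have hpd := lintegral_prod (μ := bernoulliMeasure true false p)
      (ν := (rayleighMeasure (p * lam)).prod (expMeasure μ)) (fun m => expNeg (g (x, m)))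
      (measurable_expNeg.comp (hgm.comp measurable_prodMk_left)).aemeasurable
    rw [markLaw, hpd, lintegral_bernoulliMeasure]
    simp only [hg, if_true, Bool.false_eq_true, if_false, expNeg_zero, expNeg_top, lintegral_zero,
      mul_zero, zero_add, lintegral_one, measure_univ, mul_one]
    rw [← ENNReal.ofReal_one, ← ENNReal.ofReal_sub _ (sub_nonneg.2 p.2.2)]
    congr 1; ring
  have hzero : ∀ ω, expNeg (∫⁻ x in outside ‖X j ω‖, (1 - ∫⁻ m, expNeg (g (x, m))
      ∂(markLaw (p * lam) p μ)) ∂(ENNReal.ofReal lam • (volume : Measure Plane))) = 0 := by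
    intro ω
    simp only [hu]
    rw [setLIntegral_const, volume_smul_outside hlam, ENNReal.mul_top, expNeg_top]
    simpa using hp
  simp only [hzero, lintegral_zero] at key
  have hm : Measurable fun ω => expNeg (∑' i, (outside ‖X j ω‖).indicator
      (fun x => g (x, (B i ω, Rx i ω, G i ω))) (X i ω)) :=
    measurable_expNeg.comp (Measurable.tsum fun n =>
      measurable_indicator_outside (h.measurable_X j).norm (h.measurable_X n)
        (f := fun ω x => g (x, (B n ω, Rx n ω, G n ω)))
        (hgm.comp ((h.measurable_X n).prodMk (h.measurable_mark n))))
  rw [lintegral_eq_zero_iff hm] at key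
  filter_upwards [key] with ω hω
  by_contra! hno
  have h0 : ∀ i, (outside ‖X j ω‖).indicator
      (fun x => g (x, (B i ω, Rx i ω, G i ω))) (X i ω) = 0 := by
    intro i
    by_cases hi : ‖X j ω‖ < ‖X i ω‖
    · rw [indicator_of_mem (show X i ω ∈ outside ‖X j ω‖ from hi)]
      simp [hg, hno i hi]
    · exact indicator_of_notMem (show X i ω ∉ outside ‖X j ω‖ from hi) _
  simp [h0] at hω

/-- Almost surely the interference is a convergent positive sum, and the sum of reals agrees with
the one in `[0, ∞]`. -/
lemma IsModel.ae_interference (h : IsModel P lam p μ X B Rx G) (hlam : 0 < lam)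
    (hp : 0 < (p : ℝ)) (hμ : 0 < μ) {α ε : ℝ} (hα : 2 < α) (hs : 0 ≤ α * ε) (j : ℕ) :
    ∀ᵐ ω ∂P, Summable (interferenceTerm (j + 1) α ε X B Rx G ω) ∧
      0 < interference (j + 1) α ε X B Rx G ω ∧
      interference (j + 1) α ε X B Rx G ω = (totalPower j α ε X B Rx G ω).toReal := by
  have hb : 0 < (p : ℝ) * lam := mul_pos hp hlam
  filter_upwards [h.ae_totalPower_ne_top hlam hp hμ hα hs j, h.ae_exists_interferer hlam hp hμ j,
    h.ae_mark_pos hb hμ] with ω hfin ⟨n, hn, hBn⟩ hpos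
  have hmem : ∀ i, i ∈ interferers (j + 1) X B ω ↔ X i ω ∈ outside ‖X j ω‖ ∧ B i ω = true := by
    intro i
    simp [interferers, servingDist, outside]
  have hterm : ∀ i, 0 ≤ interferenceTerm (j + 1) α ε X B Rx G ω i := by
    intro i
    refine indicator_nonneg (fun i _ => ?_) i
    have := (hpos i).1
    have := (hpos i).2
    positivity
  have heq : ∀ i, ENNReal.ofReal (interferenceTerm (j + 1) α ε X B Rx G ω i) =
      (outside ‖X j ω‖).indicator
        (fun x => receivedPower α ε (x, (B i ω, Rx i ω, G i ω))) (X i ω) := by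
    intro i
    by_cases hi : X i ω ∈ outside ‖X j ω‖
    · rw [indicator_of_mem hi]
      by_cases hBi : B i ω = true
      · rw [interferenceTerm, indicator_of_mem ((hmem i).2 ⟨hi, hBi⟩)]
        simp [receivedPower, hBi]
      · rw [interferenceTerm, indicator_of_notMem fun hc => hBi ((hmem i).1 hc).2]
        simp [receivedPower, hBi]
    · rw [indicator_of_notMem hi, interferenceTerm,
        indicator_of_notMem fun hc => hi ((hmem i).1 hc).1, ENNReal.ofReal_zero]
  have hsum : Summable (interferenceTerm (j + 1) α ε X B Rx G ω) := by
    have : ∑' i, ENNReal.ofReal (interferenceTerm (j + 1) α ε X B Rx G ω i) ≠ ∞ := by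
      rw [tsum_congr heq]; exact hfin
    have h1 := ENNReal.summable_toReal this
    simpa only [ENNReal.toReal_ofReal (hterm _)] using h1
  refine ⟨hsum, hsum.tsum_pos hterm n ?_, ?_⟩
  · rw [interferenceTerm, indicator_of_mem ((hmem n).2 ⟨hn, hBn⟩)]
    have := (hpos n).1
    have := (hpos n).2
    have : 0 < ‖X n ω‖ := (norm_nonneg _).trans_lt hn
    positivity
  · have h1 := ENNReal.ofReal_tsum_of_nonneg hterm hsum
    rw [tsum_congr heq] at h1
    rw [totalPower, ← h1, ENNReal.toReal_ofReal (tsum_nonneg hterm)]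
    rfl

end Model

end

/-! ### The conditional Laplace transform -/

section

/-- Disintegration of the joint law along the first variable. -/
lemma lintegral_condDistrib {Ω : Type*} [MeasurableSpace Ω] {P : Measure Ω} [IsFiniteMeasure P]
    {R I : Ω → ℝ} (hR : AEMeasurable R P) (hI : AEMeasurable I P) {F : ℝ × ℝ → ℝ≥0∞}
    (hF : Measurable F) :
    ∫⁻ ω, F (R ω, I ω) ∂P = ∫⁻ r, ∫⁻ x, F (r, x) ∂(condDistrib I R P r) ∂(P.map R) := by
  rw [← Measure.lintegral_compProd hF, compProd_map_condDistrib hI,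
    lintegral_map' hF.aemeasurable (hR.prodMk hI)]

lemma ae_condDistrib_nonneg {Ω : Type*} [MeasurableSpace Ω] {P : Measure Ω} [IsFiniteMeasure P]
    {R I : Ω → ℝ} (hR : AEMeasurable R P) (hI : AEMeasurable I P) (hI0 : ∀ᵐ ω ∂P, 0 ≤ I ω) :
    ∀ᵐ r ∂(P.map R), ∀ᵐ x ∂(condDistrib I R P r), 0 ≤ x := by
  refine Measure.ae_ae_of_ae_compProd (p := fun q : ℝ × ℝ => 0 ≤ q.2) ?_
  rw [compProd_map_condDistrib hI, ae_map_iff (hR.prodMk hI)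
    (measurableSet_le measurable_const measurable_snd)]
  exact hI0

lemma integrable_exp_neg_mul {κ : Measure ℝ} [IsFiniteMeasure κ] (hκ : ∀ᵐ x ∂κ, 0 ≤ x) {s : ℝ}
    (hs : 0 ≤ s) : Integrable (fun x => Real.exp (-s * x)) κ := by
  refine (integrable_const (1 : ℝ)).mono' (by fun_prop) ?_
  filter_upwards [hκ] with x hx
  rw [Real.norm_of_nonneg (Real.exp_pos _).le, Real.exp_le_one_iff]
  have := mul_nonneg hs hx
  linarith

lemma continuous_laplace {κ : Measure ℝ} [IsFiniteMeasure κ] (hκ : ∀ᵐ x ∂κ, 0 ≤ x) (μ : NNReal) :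
    Continuous fun c : NNReal => ∫ x, Real.exp (-(c * μ) * x) ∂κ := by
  refine continuous_of_dominated (bound := fun _ => 1) (fun c => by fun_prop) (fun c => ?_)
    (integrable_const _) (Eventually.of_forall fun x => by fun_prop)
  filter_upwards [hκ] with x hx
  rw [Real.norm_of_nonneg (Real.exp_pos _).le, Real.exp_le_one_iff]
  have : 0 ≤ (c : ℝ) * μ * x := by positivity
  linarith

variable {Ω : Type*} [MeasurableSpace Ω] {P : Measure Ω} {lam : ℝ} {p : unitInterval} {μ : ℝ}
  {X : ℕ → Ω → Plane} {B : ℕ → Ω → Bool} {Rx G : ℕ → Ω → ℝ}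

lemma IsModel.measurable_servingDist (h : IsModel P lam p μ X B Rx G) (k : ℕ) :
    Measurable (servingDist k X) := (h.measurable_X _).norm

variable [IsProbabilityMeasure P]

lemma IsModel.aemeasurable_interference (h : IsModel P lam p μ X B Rx G) (hlam : 0 < lam)
    (hp : 0 < (p : ℝ)) (hμ : 0 < μ) {α ε : ℝ} (hα : 2 < α) (hs : 0 ≤ α * ε) (j : ℕ) :
    AEMeasurable (interference (j + 1) α ε X B Rx G) P :=
  ⟨fun ω => (totalPower j α ε X B Rx G ω).toReal, (h.measurable_totalPower j α ε).ennreal_toReal,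
    (h.ae_interference hlam hp hμ hα hs j).mono fun _ hω => hω.2.2⟩

/-- The conditional Laplace transform at a fixed argument, with an exceptional set of distances that
may depend on it. -/
lemma IsModel.condLaplace_eq_fixed (h : IsModel P lam p μ X B Rx G) (hlam : 0 < lam)
    (hp : 0 < (p : ℝ)) (hμ : 0 < μ) {α ε : ℝ} (hα : 2 < α) (hs : 0 ≤ α * ε) (j : ℕ) {c : ℝ}
    (hc : 0 ≤ c) :
    ∀ᵐ r ∂(P.map (servingDist (j + 1) X)), condLaplace (j + 1) α ε X B Rx G P r (c * μ) =
      Real.exp (-(2 * Real.pi * p * lam * laplaceExponent (p * lam) α ε c r)) := by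
  have hR := h.measurable_servingDist (j + 1)
  have hI := h.aemeasurable_interference hlam hp hμ hα hs j
  have hFm : Measurable fun q : ℝ × ℝ => ENNReal.ofReal (Real.exp (-(c * μ) * q.2)) := by fun_prop
  have hfm : Measurable fun r => ∫⁻ x, ENNReal.ofReal (Real.exp (-(c * μ) * x))
      ∂(condDistrib (interference (j + 1) α ε X B Rx G) (servingDist (j + 1) X) P r) :=
    Measurable.lintegral_kernel_prod_right' hFm
  have hgm : Measurable fun r => ENNReal.ofReal (Real.exp
      (-(2 * Real.pi * p * lam * laplaceExponent (p * lam) α ε c r))) :=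
    ENNReal.measurable_ofReal.comp (Real.measurable_exp.comp
      ((measurable_laplaceExponent _ α ε c).const_mul _).neg)
  have : IsFiniteMeasure (P.map (servingDist (j + 1) X)) := inferInstance
  have hae := ae_eq_of_forall_setLIntegral_eq_of_sigmaFinite
    (μ := P.map (servingDist (j + 1) X)) hfm hgm fun A hA _ => by
      have h1 := lintegral_condDistrib hR.aemeasurable hI
        (F := fun q => A.indicator (fun _ => ENNReal.ofReal (Real.exp (-(c * μ) * q.2))) q.1)
        (hFm.indicator (measurable_fst hA))
      have h2 : ∀ r, ∫⁻ x, A.indicator (fun _ => ENNReal.ofReal (Real.exp (-(c * μ) * x))) r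
          ∂(condDistrib (interference (j + 1) α ε X B Rx G) (servingDist (j + 1) X) P r) =
          A.indicator (fun r => ∫⁻ x, ENNReal.ofReal (Real.exp (-(c * μ) * x))
          ∂(condDistrib (interference (j + 1) α ε X B Rx G) (servingDist (j + 1) X) P r)) r := by
        intro r
        by_cases hr : r ∈ A <;> simp [hr]
      simp only [h2] at h1
      rw [lintegral_indicator hA] at h1
      have hRA : MeasurableSet {ω | ‖X j ω‖ ∈ A} := hR hA
      rw [← h1, setLIntegral_map hA hgm hR]
      refine Eq.trans ?_ (h.setLIntegral_expNeg_totalPower hlam hp hμ hα hs j hc hA)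
      rw [← lintegral_indicator hRA]
      refine lintegral_congr_ae ?_
      filter_upwards [h.ae_interference hlam hp hμ hα hs j,
        h.ae_totalPower_ne_top hlam hp hμ hα hs j] with ω hω hfin
      by_cases hr : ‖X j ω‖ ∈ A
      · rw [indicator_of_mem (show ω ∈ {ω | ‖X j ω‖ ∈ A} from hr),
          indicator_of_mem (show servingDist (j + 1) X ω ∈ A from hr), hω.2.2,
          ← ENNReal.ofReal_toReal hfin, ← ENNReal.ofReal_mul (by positivity),
          expNeg_ofReal (by positivity), ENNReal.toReal_ofReal (by positivity), neg_mul]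
      · rw [indicator_of_notMem (show ω ∉ {ω | ‖X j ω‖ ∈ A} from hr),
          indicator_of_notMem (show servingDist (j + 1) X ω ∉ A from hr)]
  filter_upwards [hae] with r hr
  rw [condLaplace, integral_eq_lintegral_of_nonneg_ae
    (Eventually.of_forall fun x => (Real.exp_pos _).le) (by fun_prop)]
  rw [hr, ENNReal.toReal_ofReal (Real.exp_pos _).le]

/-- The conditional Laplace transform at all arguments at once: both sides are continuous in `c`, so
it suffices to treat a countable dense set of values of `c`. -/
lemma IsModel.condLaplace_eq (h : IsModel P lam p μ X B Rx G) (hlam : 0 < lam)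
    (hp : 0 < (p : ℝ)) (hμ : 0 < μ) {α ε : ℝ} (hα : 2 < α) (hs : 0 ≤ α * ε) (j : ℕ) :
    ∀ᵐ r ∂(P.map (servingDist (j + 1) X)), ∀ c : ℝ, 0 ≤ c →
      condLaplace (j + 1) α ε X B Rx G P r (c * μ) =
        Real.exp (-(2 * Real.pi * p * lam * laplaceExponent (p * lam) α ε c r)) := by
  have hb : 0 < (p : ℝ) * lam := mul_pos hp hlam
  have hR := h.measurable_servingDist (j + 1)
  have hI := h.aemeasurable_interference hlam hp hμ hα hs j
  have hpos : ∀ᵐ r ∂(P.map (servingDist (j + 1) X)), 0 < r :=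
    (ae_map_iff hR.aemeasurable measurableSet_Ioi).2 (h.ae_norm_pos hlam j)
  have hdense : ∀ᵐ r ∂(P.map (servingDist (j + 1) X)), ∀ n,
      condLaplace (j + 1) α ε X B Rx G P r (TopologicalSpace.denseSeq NNReal n * μ) =
        Real.exp (-(2 * Real.pi * p * lam *
          laplaceExponent (p * lam) α ε (TopologicalSpace.denseSeq NNReal n) r)) :=
    ae_all_iff.2 fun n => h.condLaplace_eq_fixed hlam hp hμ hα hs j (NNReal.coe_nonneg _)
  have hnn := ae_condDistrib_nonneg hR.aemeasurable hI
    ((h.ae_interference hlam hp hμ hα hs j).mono fun ω hω => hω.2.1.le)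
  filter_upwards [hdense, hpos, hnn] with r hd hr hκ c hc
  have h1 := continuous_laplace hκ ⟨μ, hμ.le⟩
  have h2 : Continuous fun c : NNReal => Real.exp (-(2 * Real.pi * p * lam *
      laplaceExponent (p * lam) α ε c r)) :=
    Real.continuous_exp.comp (((continuous_laplaceExponent hb hα hs hr).const_mul _).neg)
  have := (TopologicalSpace.denseRange_denseSeq NNReal).equalizer h1 h2 (funext fun n => hd n)
  exact congrFun this ⟨c, hc⟩

end

/-! ### The coverage probability -/

section

/-- A term of an independent sequence is independent of the sequence with this term overwritten. -/
lemma indepFun_update_of_iIndepFun {Ω 𝓜 : Type*} [MeasurableSpace Ω] [MeasurableSpace 𝓜]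
    {P : Measure Ω} {M : ℕ → Ω → 𝓜} (hM : ∀ n, Measurable (M n)) (hi : iIndepFun M P) (j : ℕ)
    (d : 𝓜) : IndepFun (M j) (fun ω => Function.update (fun n => M n ω) j d) P := by
  have h := indep_iSup_of_disjoint (fun i => (hM i).comap_le) hi.iIndep
    (S := {j}) (T := {j}ᶜ) disjoint_compl_right
  refine indep_of_indep_of_le_left (indep_of_indep_of_le_right h ?_) ?_
  · refine measurable_iff_comap_le.1 (@measurable_pi_lambda _ _ _ (_) _ _ fun n => ?_)
    by_cases hn : n = j
    · subst hn
      simp only [Function.update_self]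
      exact measurable_const
    · simp only [Function.update_of_ne hn]
      refine measurable_iff_comap_le.2 (le_iSup₂_of_le n hn le_rfl)
  · exact le_iSup₂_of_le j rfl le_rfl

lemma lt_sinr_iff {Ω : Type*} {X : ℕ → Ω → Plane} {B : ℕ → Ω → Bool} {Rx G : ℕ → Ω → ℝ}
    {k : ℕ} {α ε t σ : ℝ} {ω : Ω} (hI : 0 < interference k α ε X B Rx G ω)
    (hR : 0 < servingDist k X ω) :
    t < sinr k α ε X B Rx G σ ω ↔
      t * servingDist k X ω ^ (α * (1 - ε)) * (interference k α ε X B Rx G ω + σ ^ 2) <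
        G (k - 1) ω := by
  have hD : 0 < interference k α ε X B Rx G ω + σ ^ 2 := by positivity
  have hpw : 0 < servingDist k X ω ^ (α * (1 - ε)) := by positivity
  have hinv : servingDist k X ω ^ (α * (ε - 1)) = (servingDist k X ω ^ (α * (1 - ε)))⁻¹ := by
    rw [← Real.rpow_neg hR.le]; congr 1; ring
  rw [sinr, lt_div_iff₀ hD, hinv, ← div_eq_mul_inv, lt_div_iff₀ hpw]
  constructor <;> intro h <;> linarith

variable {Ω : Type*} [MeasurableSpace Ω] {P : Measure Ω} {lam : ℝ} {p : unitInterval} {μ : ℝ}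
  {X : ℕ → Ω → Plane} {B : ℕ → Ω → Bool} {Rx G : ℕ → Ω → ℝ} [IsProbabilityMeasure P]

/-- The fading of the `j`-th user is exponential given the other marks and the locations; hence
the probability that it exceeds a threshold depending on the serving distance and on the
interference, to which the `j`-th user does not contribute. -/
lemma IsModel.measure_lt_fading (h : IsModel P lam p μ X B Rx G) (hlam : 0 < lam)
    (hp : 0 < (p : ℝ)) (hμ : 0 < μ) (α ε : ℝ) (j : ℕ) {T : ℝ → ℝ≥0∞ → ℝ}
    (hT : Measurable fun q : ℝ × ℝ≥0∞ => T q.1 q.2) (hT0 : ∀ r, 0 ≤ r → ∀ y, 0 ≤ T r y) :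
    P {ω | T ‖X j ω‖ (totalPower j α ε X B Rx G ω) < G j ω} =
      ∫⁻ ω, ENNReal.ofReal
        (Real.exp (-(μ * T ‖X j ω‖ (totalPower j α ε X B Rx G ω)))) ∂P := by
  have hb : 0 < (p : ℝ) * lam := mul_pos hp hlam
  set d : Bool × ℝ × ℝ := (false, 0, 0)
  set M : ℕ → Ω → Bool × ℝ × ℝ := fun n ω => (B n ω, Rx n ω, G n ω) with hMdef
  have hM : ∀ n, Measurable (M n) := h.measurable_mark
  set M' : Ω → ℕ → Bool × ℝ × ℝ := fun ω => Function.update (fun n => M n ω) j d with hM'def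
  have hup : Measurable fun m : ℕ → Bool × ℝ × ℝ => Function.update m j d :=
    measurable_update_left
  have hM' : Measurable M' := hup.comp (measurable_pi_lambda _ hM)
  have hX : Measurable fun ω n => X n ω := measurable_pi_lambda _ h.measurable_X
  -- the interference as a function of the locations and of the marks other than the `j`-th one
  set Φ : (ℕ → Plane) × (ℕ → Bool × ℝ × ℝ) → ℝ≥0∞ := fun q =>
    ∑' n, (outside ‖q.1 j‖).indicator (fun x => receivedPower α ε (x, q.2 n)) (q.1 n) with hΦ
  have hΦm : Measurable Φ := by
    have hx : ∀ i, Measurable fun q : (ℕ → Plane) × (ℕ → Bool × ℝ × ℝ) => q.1 i := fun i =>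
      (measurable_pi_apply i).comp measurable_fst
    have hm : ∀ i, Measurable fun q : (ℕ → Plane) × (ℕ → Bool × ℝ × ℝ) => q.2 i := fun i =>
      (measurable_pi_apply i).comp measurable_snd
    refine Measurable.tsum fun n => ?_
    exact measurable_indicator_outside (hx j).norm (hx n)
      (f := fun q x => receivedPower α ε (x, q.2 n))
      ((measurable_receivedPower α ε).comp ((hx n).prodMk (hm n)))
  have hΦM : ∀ ω, Φ (fun n => X n ω, M' ω) = totalPower j α ε X B Rx G ω := by
    intro ω
    refine tsum_congr fun n => ?_
    by_cases hn : n = j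
    · subst hn
      have : X n ω ∉ outside ‖X n ω‖ := lt_irrefl ‖X n ω‖
      rw [indicator_of_notMem this, indicator_of_notMem this]
    · simp only [hM'def, Function.update_of_ne hn, hMdef]
  set S : (ℕ → Plane) × (ℕ → Bool × ℝ × ℝ) → ℝ := fun q => T ‖q.1 j‖ (Φ q) with hS
  have hSm : Measurable S :=
    hT.comp ((((measurable_pi_apply j).comp measurable_fst).norm).prodMk hΦm)
  set F : (ℕ → Plane) × ((Bool × ℝ × ℝ) × (ℕ → Bool × ℝ × ℝ)) → ℝ≥0∞ :=
    {q | S (q.1, q.2.2) < q.2.1.2.2}.indicator 1 with hF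
  have hFm : Measurable F := by
    refine measurable_one.indicator (measurableSet_lt ?_ ?_)
    · exact hSm.comp (measurable_fst.prodMk (measurable_snd.comp measurable_snd))
    · fun_prop
  have hind1 : IndepFun (fun ω n => X n ω) (fun ω => (M j ω, M' ω)) P :=
    h.indep_mark.comp measurable_id ((measurable_pi_apply j).prodMk hup)
  have hind2 : IndepFun (M j) M' P := indepFun_update_of_iIndepFun hM h.iIndep_mark j d
  have hGe : ∀ y, 0 ≤ y → P {ω | y < G j ω} = ENNReal.ofReal (Real.exp (-(μ * y))) := by
    intro y hy
    rw [(h.hasLaw_G hb hμ j).measure_eq (p := fun g => y < g) measurableSet_Ioi]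
    exact expMeasure_Ioi hμ hy
  have hE : MeasurableSet {ω | T ‖X j ω‖ (totalPower j α ε X B Rx G ω) < G j ω} :=
    measurableSet_lt (hT.comp ((h.measurable_X j).norm.prodMk (h.measurable_totalPower j α ε)))
      (h.measurable_G j)
  have h1 := lintegral_comp_prodMk_of_indepFun hX ((hM j).prodMk hM') hind1 hFm
  have hK : Measurable fun q : (ℕ → Plane) × (ℕ → Bool × ℝ × ℝ) =>
      ENNReal.ofReal (Real.exp (-(μ * S q))) := by fun_prop
  have h2 := lintegral_comp_prodMk_of_indepFun hX hM'
    (h.indep_mark.comp measurable_id hup) hK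
  rw [← lintegral_indicator_one hE]
  calc ∫⁻ ω, {ω | T ‖X j ω‖ (totalPower j α ε X B Rx G ω) < G j ω}.indicator 1 ω ∂P
      = ∫⁻ ω, F (fun n => X n ω, (M j ω, M' ω)) ∂P := by
        refine lintegral_congr fun ω => ?_
        simp only [hF, hS, indicator, mem_ofPred_eq, hΦM]
        rfl
    _ = ∫⁻ ω, ∫⁻ ω', F (fun n => X n ω, (M j ω', M' ω')) ∂P ∂P := h1
    _ = ∫⁻ ω, ∫⁻ ω', ENNReal.ofReal (Real.exp (-(μ * S (fun n => X n ω, M' ω')))) ∂P ∂P := by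
        refine lintegral_congr fun ω => ?_
        have h3 := lintegral_comp_prodMk_of_indepFun hM' (hM j) hind2.symm
          (F := fun q => F (fun n => X n ω, (q.2, q.1)))
          (hFm.comp (measurable_const.prodMk (measurable_snd.prodMk measurable_fst)))
        simp only at h3
        rw [h3]
        refine lintegral_congr fun ω' => ?_
        have h4 : (fun ω'' => F (fun n => X n ω, (M j ω'', M' ω'))) =
            {ω'' | S (fun n => X n ω, M' ω') < G j ω''}.indicator 1 := by
          ext ω''
          simp only [hF, indicator, mem_ofPred_eq]
          rfl
        rw [h4, lintegral_indicator_one (measurableSet_lt measurable_const (h.measurable_G j)),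
          hGe _ (hT0 _ (norm_nonneg _) _)]
    _ = ∫⁻ ω, ENNReal.ofReal
        (Real.exp (-(μ * T ‖X j ω‖ (totalPower j α ε X B Rx G ω)))) ∂P := by
        rw [← h2]
        refine lintegral_congr fun ω => ?_
        simp only [hS, hΦM]

/-- The coverage probability, as an integral against the law of the serving distance. -/
lemma IsModel.measure_lt_sinr (h : IsModel P lam p μ X B Rx G) (hlam : 0 < lam)
    (hp : 0 < (p : ℝ)) (hμ : 0 < μ) {α ε t : ℝ} (hα : 2 < α) (hs : 0 ≤ α * ε) (ht : 0 < t)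
    (σ : ℝ) (j : ℕ) :
    P {ω | t < sinr (j + 1) α ε X B Rx G σ ω} =
      ∫⁻ r, ENNReal.ofReal (xi (j + 1) α ε X B Rx G P μ t σ r)
        ∂(P.map (servingDist (j + 1) X)) := by
  have hR := h.measurable_servingDist (j + 1)
  have hI := h.aemeasurable_interference hlam hp hμ hα hs j
  have haeI := h.ae_interference hlam hp hμ hα hs j
  have hpos : ∀ᵐ r ∂(P.map (servingDist (j + 1) X)), 0 < r :=
    (ae_map_iff hR.aemeasurable measurableSet_Ioi).2 (h.ae_norm_pos hlam j)
  have hnn := ae_condDistrib_nonneg hR.aemeasurable hI (haeI.mono fun ω hω => hω.2.1.le)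
  have hae : {ω | t < sinr (j + 1) α ε X B Rx G σ ω} =ᵐ[P]
      {ω | t * ‖X j ω‖ ^ (α * (1 - ε)) *
        ((totalPower j α ε X B Rx G ω).toReal + σ ^ 2) < G j ω} := by
    filter_upwards [haeI, h.ae_norm_pos hlam j] with ω hω hRω
    have h1 := lt_sinr_iff (t := t) (σ := σ) (ε := ε) (α := α) hω.2.1
      (show 0 < servingDist (j + 1) X ω from hRω)
    rw [hω.2.2] at h1
    exact propext h1
  have hTm : Measurable fun q : ℝ × ℝ≥0∞ =>
      t * q.1 ^ (α * (1 - ε)) * (q.2.toReal + σ ^ 2) :=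
    ((measurable_fst.pow_const _).const_mul t).mul
      (measurable_snd.ennreal_toReal.add measurable_const)
  rw [measure_congr hae, h.measure_lt_fading hlam hp hμ α ε j
    (T := fun r y => t * r ^ (α * (1 - ε)) * (y.toReal + σ ^ 2)) hTm
    (fun r hr y => by positivity)]
  have hFm : Measurable fun q : ℝ × ℝ => ENNReal.ofReal
      (Real.exp (-(μ * (t * q.1 ^ (α * (1 - ε)) * (q.2 + σ ^ 2))))) := by fun_prop
  have hdis := lintegral_condDistrib hR.aemeasurable hI hFm
  refine Eq.trans (lintegral_congr_ae ?_) (hdis.trans (lintegral_congr_ae ?_))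
  · filter_upwards [haeI] with ω hω
    rw [hω.2.2]
    rfl
  · filter_upwards [hpos, hnn] with r hr hκ
    have hs0 : 0 ≤ μ * t * r ^ (α * (1 - ε)) := by positivity
    rw [xi, condLaplace, ← integral_const_mul, ofReal_integral_eq_lintegral_ofReal
      ((integrable_exp_neg_mul hκ hs0).const_mul _)
      (Eventually.of_forall fun x => by positivity)]
    refine lintegral_congr fun x => ?_
    rw [← Real.exp_add]
    congr 2; ring

lemma measurable_xi (k : ℕ) (α ε μ t σ : ℝ) :
    Measurable fun r => xi k α ε X B Rx G P μ t σ r := by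
  have h1 : Measurable fun r => condLaplace k α ε X B Rx G P r (μ * t * r ^ (α * (1 - ε))) := by
    have hm : Measurable fun q : ℝ × ℝ => Real.exp (-(μ * t * q.1 ^ (α * (1 - ε))) * q.2) := by
      fun_prop
    exact (StronglyMeasurable.integral_kernel_prod_right'
      (κ := condDistrib (interference k α ε X B Rx G) (servingDist k X) P)
      hm.stronglyMeasurable).measurable
  exact (by fun_prop : Measurable fun r : ℝ =>
    Real.exp (-μ * t * σ ^ 2 * r ^ (α * (1 - ε)))).mul h1

lemma xi_nonneg (k : ℕ) (α ε μ t σ r : ℝ) : 0 ≤ xi k α ε X B Rx G P μ t σ r :=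
  mul_nonneg (Real.exp_pos _).le (integral_nonneg fun _ => (Real.exp_pos _).le)

end

end Uplink

end

theorem lemma2 {Ω : Type*} [MeasurableSpace Ω] (P : Measure Ω) [IsProbabilityMeasure P]
    (k : ℕ) (hk : 1 ≤ k) (t lam : ℝ) (p : unitInterval) (α ε μ σ : ℝ)
    (ht : 0 < t) (hlam : 0 < lam) (hp : 0 < (p : ℝ)) (hα : 2 < α) (hε : 0 ≤ ε) (hμ : 0 < μ)
    (X : ℕ → Ω → Uplink.Plane) (B : ℕ → Ω → Bool) (Rx G : ℕ → Ω → ℝ)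
    (hmodel : Uplink.IsModel P lam p μ X B Rx G) :
    -- the interference is almost surely a convergent sum with positive value
    (∀ᵐ ω ∂P, Summable (Uplink.interferenceTerm k α ε X B Rx G ω) ∧
      0 < Uplink.interference k α ε X B Rx G ω) ∧
    -- the density of the distance of the `k`-th user
    HasLaw (Uplink.servingDist k X)
      ((volume.restrict (Ioi 0)).withDensity fun r =>
        ENNReal.ofReal (Uplink.distDensity k lam r)) P ∧
    -- the integrals in the Laplace transform converge
    (∀ r : ℝ, 0 < r →
      (∀ v : ℝ, r < v → IntegrableOn (Uplink.innerIntegrand (p * lam) t α ε r v) (Ioi 0)) ∧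
      IntegrableOn (Uplink.outerIntegrand (p * lam) t α ε r) (Ioi r)) ∧
    -- the conditional Laplace transform of the interference
    (∀ᵐ r ∂(volume.restrict (Ioi (0 : ℝ))),
      Uplink.condLaplace k α ε X B Rx G P r (μ * t * r ^ (α * (1 - ε))) =
        Real.exp (-2 * Real.pi * p * lam *
          ∫ v in Ioi r, Uplink.outerIntegrand (p * lam) t α ε r v)) ∧
    -- the coverage probability
    IntegrableOn (fun r => Uplink.xi k α ε X B Rx G P μ t σ r * Uplink.distDensity k lam r)
      (Ioi 0) ∧
    P.real {ω | t < Uplink.sinr k α ε X B Rx G σ ω} =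
      ∫ r in Ioi (0 : ℝ),
        Uplink.xi k α ε X B Rx G P μ t σ r * Uplink.distDensity k lam r := by
  have hb : 0 < (p : ℝ) * lam := mul_pos hp hlam
  have hs : 0 ≤ α * ε := by positivity
  obtain ⟨j, rfl⟩ : ∃ j, k = j + 1 := ⟨k - 1, by omega⟩
  have hae := hmodel.ae_interference hlam hp hμ hα hs j
  have hlaw : HasLaw (Uplink.servingDist (j + 1) X) ((volume.restrict (Ioi 0)).withDensity fun r =>
      ENNReal.ofReal (Uplink.distDensity (j + 1) lam r)) P := hmodel.hasLaw_norm hlam j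
  have hdm : Measurable fun r => ENNReal.ofReal (Uplink.distDensity (j + 1) lam r) :=
    ENNReal.measurable_ofReal.comp (Uplink.continuous_distDensity _ _).measurable
  have hprob : P {ω | t < Uplink.sinr (j + 1) α ε X B Rx G σ ω} =
      ∫⁻ r in Ioi (0 : ℝ), ENNReal.ofReal
        (Uplink.xi (j + 1) α ε X B Rx G P μ t σ r * Uplink.distDensity (j + 1) lam r) := by
    rw [hmodel.measure_lt_sinr hlam hp hμ hα hs ht σ j, hlaw.map_eq,
      lintegral_withDensity_eq_lintegral_mul _ hdm
        (Uplink.measurable_xi (j + 1) α ε μ t σ).ennreal_ofReal]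
    refine lintegral_congr fun r => ?_
    rw [Pi.mul_apply, mul_comm, ENNReal.ofReal_mul (Uplink.xi_nonneg ..)]
  have hnn : 0 ≤ᵐ[volume.restrict (Ioi (0 : ℝ))] fun r =>
      Uplink.xi (j + 1) α ε X B Rx G P μ t σ r * Uplink.distDensity (j + 1) lam r := by
    filter_upwards [ae_restrict_mem measurableSet_Ioi] with r hr
    exact mul_nonneg (Uplink.xi_nonneg ..) (Uplink.distDensity_nonneg hlam (le_of_lt hr))
  have hmeas : AEStronglyMeasurable (fun r =>
      Uplink.xi (j + 1) α ε X B Rx G P μ t σ r * Uplink.distDensity (j + 1) lam r)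
      (volume.restrict (Ioi (0 : ℝ))) :=
    ((Uplink.measurable_xi (j + 1) α ε μ t σ).mul
      (Uplink.continuous_distDensity _ _).measurable).aestronglyMeasurable
  refine ⟨hae.mono fun ω hω => ⟨hω.1, hω.2.1⟩, hlaw, fun r hr => ⟨fun v hv => ?_, ?_⟩, ?_, ?_, ?_⟩
  · exact Uplink.integrableOn_markIntegrand hb (by positivity) (hr.trans hv).le
  · exact Uplink.integrableOn_exponentIntegrand hb hα hs (by positivity) hr
  · have h1 := hmodel.condLaplace_eq hlam hp hμ hα hs j
    rw [hlaw.map_eq, ae_withDensity_iff hdm] at h1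
    filter_upwards [h1, ae_restrict_mem measurableSet_Ioi] with r hr hr0
    have hr0 : (0 : ℝ) < r := hr0
    have h2 := hr (by simpa using Uplink.distDensity_pos hlam hr0) (t * r ^ (α * (1 - ε)))
      (by positivity)
    rw [show μ * t * r ^ (α * (1 - ε)) = t * r ^ (α * (1 - ε)) * μ by ring, h2]
    congr 1
    rw [show ∫ v in Ioi r, Uplink.outerIntegrand (p * lam) t α ε r v =
      Uplink.laplaceExponent (p * lam) α ε (t * r ^ (α * (1 - ε))) r from rfl]
    ring
  · refine ⟨hmeas, (hasFiniteIntegral_iff_ofReal hnn).2 ?_⟩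
    rw [← hprob]
    exact measure_lt_top _ _
  · rw [integral_eq_lintegral_of_nonneg_ae hnn hmeas, ← hprob, measureReal_def]
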